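/- Let $L/\mathbb{Q}$ be a biquadratic extension, $L=\mathbb{Q}(\sqrt a,\sqrt b)$ with $[L:\mathbb{Q}]=4$, where $a,b\in\mathbb{Z}$ are square-free and $a\equiv 1\pmod 4$. Let $G=\mathrm{Gal}(L/\mathbb{Q})$ and let $g=\gcd(a,b)>0$. A Hopf–Galois structure on $L/\mathbb{Q}$ is a finite-dimensional cocommutative $\mathbb{Q}$-Hopf algebra $H$ acting $\mathbb{Q}$-linearly on $L$ so that $L$ is a left $H$-module algebra and the map $L\otimes_{\mathbb{Q}}H\to\mathrm{End}_{\mathbb{Q}}(L)$, $x\otimes h\mapsto (y\mapsto x(h\cdot y))$, is bijective. Let $H$ be the non-classical Hopf–Galois structure on $L/\mathbb{Q}$ given by $\sqrt a$, that is (up to isomorphism), $H=L[N]^G$, where, writing $\mathrm{Gal}(L/\mathbb{Q}(\sqrt a))=\langle\tau\rangle$ and choosing $\sigma\in G\setminus\langle\tau\rangle$, $N=\langle\mu,\eta\rangle\le\mathrm{Perm}(G)$ is the cyclic group of order $4$ generated by $$\mu(\sigma^k\tau^l)=\sigma^k\tau^{l-1},\qquad \eta(\sigma^k\tau^l)=\sigma^{k-1}\tau^{l+k-1};$$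 $G$ acts on $L[N]$ through the Galois action on coefficients and through conjugation by left translations on $N$; and $H$ acts on $L$ by $\bigl(\sum_{\pi}c_\pi\pi\bigr)\cdot v=\sum_\pi c_\pi\,\bigl(\pi^{-1}(1_G)\bigr)(v)$. Let $\mathfrak{A}_H=\{h\in H : h\cdot\mathcal{O}_L\subseteq\mathcal{O}_L\}$ be the associated order. Then $H\cong\mathbb{Q}^2\times\mathbb{Q}(\sqrt{-a})$ as $\mathbb{Q}$-algebras, and $\mathcal{O}_L$ is free as an $\mathfrak{A}_H$-module if and only if there are $x,y\in\mathbb{Z}$ with $x^2+ay^2=2g$ or $x^2+ay^2=-2g$. -/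

import Mathlib

open scoped TensorProduct

noncomputable section

/-- The canonical map `j : L ⊗ H → End_K(L)`, `j (x ⊗ h) (y) = x * (h • y)`. -/
def hopfGaloisMap (K L H : Type*) [Field K] [Field L] [Algebra K L] [Ring H] [Algebra K H]
    [Module H L] [IsScalarTower K H L] : L ⊗[K] H →ₗ[K] Module.End K L :=
  LinearMap.mul' K (Module.End K L) ∘ₗ
    TensorProduct.map (Algebra.lmul K L).toLinearMap (Algebra.lsmul K K L).toLinearMap

/-- `H`, with its given action on `L`, is a Hopf-Galois structure on the field extension `L / K`:
`H` is a finite-dimensional cocommutative `K`-Hopf algebra, `L` is a left `H`-module algebra,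
and the canonical map `j : L ⊗ H → End_K(L)` is bijective. -/
structure IsHopfGaloisStructure (K L H : Type*) [Field K] [Field L] [Algebra K L] [Ring H]
    [HopfAlgebra K H] [Module H L] [IsScalarTower K H L] : Prop where
  finiteDimensional : FiniteDimensional K H
  isCocomm : Coalgebra.IsCocomm K H
  smul_one : ∀ h : H, h • (1 : L) = algebraMap K L (Coalgebra.counit h)
  /-- `h • (x * y) = ∑ (h₁ • x) * (h₂ • y)` -/
  smul_mul : ∀ (h : H) (x y : L), h • (x * y) =
    LinearMap.mul' K L (TensorProduct.map
      ((Algebra.lsmul K K L).toLinearMap.flip x) ((Algebra.lsmul K K L).toLinearMap.flip y)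
      (Coalgebra.comul (R := K) h))
  bijective : Function.Bijective (hopfGaloisMap K L H)

/-- For a group `G` generated by two commuting elements `σ`, `τ` of order two and `T = ⟨τ⟩`, the
subgroup `N_{T,1} = ⟨μ, η⟩` of `Perm G` generated by the permutations
`μ (σ ^ k * τ ^ l) = σ ^ k * τ ^ (l - 1)` and
`η (σ ^ k * τ ^ l) = σ ^ (k - 1) * τ ^ (l + (k - 1))`. It is cyclic of order four. -/
def cyclicRegularSubgroup {G : Type*} [Group G] (σ τ : G) : Subgroup (Equiv.Perm G) :=
  Subgroup.closure
    ({μ | ∀ k l : ℤ, μ (σ ^ k * τ ^ l) = σ ^ k * τ ^ (l - 1)} ∪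
      {η | ∀ k l : ℤ, η (σ ^ k * τ ^ l) = σ ^ (k - 1) * τ ^ (l + (k - 1))})

/-- The action of `g ∈ G = Gal(L/K)` on `L[Perm G]`: the Galois action on the coefficients, and
conjugation by the left translation `λ(g)` on the permutations. -/
def galoisActPerm (K L : Type*) [Field K] [Field L] [Algebra K L] (g : L ≃ₐ[K] L) :
    MonoidAlgebra L (Equiv.Perm (L ≃ₐ[K] L)) →ₐ[K] MonoidAlgebra L (Equiv.Perm (L ≃ₐ[K] L)) :=
  (MonoidAlgebra.mapDomainAlgHom K L
      (MulAut.conj (Equiv.mulLeft g : Equiv.Perm (L ≃ₐ[K] L))).toMonoidHom).comp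
    (MonoidAlgebra.mapAlgHom (Equiv.Perm (L ≃ₐ[K] L)) g.toAlgHom)

/-- The Greither-Pareigis algebra `L[N]^G` of a subgroup `N` of `Perm G`, `G = Gal(L/K)`,
realised inside `L[Perm G]`. -/
def greitherPareigisAlgebra (K L : Type*) [Field K] [Field L] [Algebra K L]
    (N : Subgroup (Equiv.Perm (L ≃ₐ[K] L))) :
    Subalgebra K (MonoidAlgebra L (Equiv.Perm (L ≃ₐ[K] L))) :=
  (MonoidAlgebra.mapDomainAlgHom K L N.subtype).range ⊓
    ⨅ g : L ≃ₐ[K] L, AlgHom.equalizer (galoisActPerm K L g) (AlgHom.id K _)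

/-- The Greither-Pareigis action `(∑ c_π π) · v = ∑ c_π (π⁻¹(1_G))(v)`. -/
def greitherPareigisAct {K L : Type*} [Field K] [Field L] [Algebra K L]
    (x : MonoidAlgebra L (Equiv.Perm (L ≃ₐ[K] L))) (v : L) : L :=
  x.coeff.sum fun π c => c * (π⁻¹ (1 : L ≃ₐ[K] L)) v

/-- For a biquadratic extension `L / K` and `z ∈ L ∖ K` with `z ^ 2 ∈ K`: the algebra `H`, with its
action on `L`, is the one given by `z`, i.e. it is `L[N]^G` with `N = N_{T,1}`, `T = Gal(L/K(z))`.
(The comultiplication and counit of a Hopf-Galois structure are determined by its action.) -/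
def IsGivenBy (K L H : Type*) [Field K] [Field L] [Algebra K L] [Ring H] [Algebra K H]
    [Module H L] (z : L) : Prop :=
  ∃ σ τ : L ≃ₐ[K] L, τ ≠ 1 ∧ τ z = z ∧ σ z ≠ z ∧
    ∃ φ : H ≃ₐ[K] greitherPareigisAlgebra K L (cyclicRegularSubgroup σ τ),
      ∀ (h : H) (v : L), h • v = greitherPareigisAct (φ h).1 v

/-- The associated order `𝔄_H = {h ∈ H | h • 𝓞 L ⊆ 𝓞 L}`. -/
def associatedOrder (L H : Type*) [Field L] [Ring H] [Module H L] : Subring H where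
  carrier := {h | ∀ x : L, IsIntegral ℤ x → IsIntegral ℤ (h • x)}
  mul_mem' ha hb x hx := by rw [mul_smul]; exact ha _ (hb _ hx)
  one_mem' x hx := by rwa [one_smul]
  add_mem' ha hb x hx := by rw [add_smul]; exact (ha _ hx).add (hb _ hx)
  zero_mem' x _ := by rw [zero_smul]; exact isIntegral_zero
  neg_mem' ha x hx := by rw [neg_smul]; exact (ha _ hx).neg

/-- The ring of integers of `L` as a module over the associated order. -/
instance associatedOrder.instModule (L H : Type*) [Field L] [Ring H] [Module H L] :
    Module (associatedOrder L H) (NumberField.RingOfIntegers L) where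
  smul h x := ⟨(h : H) • (x : L), h.2 x x.2⟩
  one_smul x := Subtype.ext (one_smul H (x : L))
  mul_smul a b x := Subtype.ext (mul_smul (a : H) (b : H) (x : L))
  smul_zero a := Subtype.ext (smul_zero (a : H))
  smul_add a x y := Subtype.ext (smul_add (a : H) (x : L) (y : L))
  add_smul a b x := Subtype.ext (add_smul (a : H) (b : H) (x : L))
  zero_smul x := Subtype.ext (zero_smul H (x : L))

end

/-! Write a = g a', b = g b' and √c = √a√b / g. In the basis 1, √a, √b, √c the algebra H acts by
rational scalars on the lines of 1 and √a, and through ℚ(√-a) on the plane of √b, √c, where ω = √-a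
sends √b to g√c and √c to -a'√b. This identifies H with ℚ × ℚ × ℚ(√-a) (`exists_actsAs`,
`exists_algEquiv_actsAs`) and turns freeness into a question about a lattice in ℚ⁴.

Since a ≡ 1 mod 4, g and a' are odd and congruent mod 4, so c ≡ b mod 4. Hence the lattice of
integers has just two shapes, according to whether b ≡ 1 mod 4 (`isIntegral_iff_quarter`,
`isIntegral_iff_half`). As H is commutative and L is cyclic over it, a free 𝓞 L has rank one
(`exists_generates_of_free`), so freeness means that the lattice has a generator over its multiplier
ring.

Suppose (X, Y)/M are the last two coordinates of a generator. Multipliers p + qω have p, q ∈ ℤ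
(`Preserves.isInt`), and the map (p, q) ↦ (p + qω)(X, Y) has determinant gX² + a'Y². Its integral
image must contain the index-two lattice Z ≡ W mod 2, to which (X, Y) itself belongs, so gX² + a'Y²
is even and divides 2: it is ±2 (`Generates.norm_eq`). Conversely a solution of gX² + a'Y² = ±2 has
X, Y odd, and inverting that determinant gives explicit multipliers (`HalfLattice.exists_generates`,
`QuarterLattice.exists_generates`). Finally x = gX converts this equation into x² + ay² = ±2g, g
being squarefree. -/

/-! ### Arithmetic of the two lattices and of their generators -/

/-- The coordinates, with respect to `1, √a, √b, √(ab)/g`, of the integers of `ℚ(√a, √b)` when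
`a ≡ b ≡ 1 mod 4`. -/
def QuarterLattice (g : ℤ) (x₀ x₁ x₂ x₃ : ℚ) : Prop :=
  ∃ n₀ n₁ n₂ n₃ : ℤ, x₀ = n₀ / 4 ∧ x₁ = n₁ / 4 ∧ x₂ = n₂ / 4 ∧ x₃ = n₃ / 4 ∧
    2 ∣ n₁ - n₀ ∧ 2 ∣ n₂ - n₀ ∧ 2 ∣ n₃ - n₀ ∧ 4 ∣ n₀ + n₁ + n₂ + g * n₃

/-- The coordinates, with respect to `1, √a, √b, √(ab)/g`, of the integers of `ℚ(√a, √b)` when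
`a ≡ 1` and `b ≢ 1 mod 4`. -/
def HalfLattice (x₀ x₁ x₂ x₃ : ℚ) : Prop :=
  ∃ n₀ n₁ n₂ n₃ : ℤ, x₀ = n₀ / 2 ∧ x₁ = n₁ / 2 ∧ x₂ = n₂ / 2 ∧ x₃ = n₃ / 2 ∧
    2 ∣ n₁ - n₀ ∧ 2 ∣ n₃ - n₂

/-- The element `(p₀, p₁, p + q ω)` of `ℚ × ℚ × ℚ(√-a)`, `a = g a'`, preserves the lattice `I`. -/
def Preserves (I : ℚ → ℚ → ℚ → ℚ → Prop) (g a' : ℤ) (p₀ p₁ p q : ℚ) : Prop :=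
  ∀ x₀ x₁ x₂ x₃, I x₀ x₁ x₂ x₃ →
    I (p₀ * x₀) (p₁ * x₁) (p * x₂ - a' * q * x₃) (p * x₃ + g * q * x₂)

/-- `(x₀, x₁, x₂, x₃)` generates the lattice `I` over its multiplier ring. -/
def Generates (I : ℚ → ℚ → ℚ → ℚ → Prop) (g a' : ℤ) (x₀ x₁ x₂ x₃ : ℚ) : Prop :=
  ∀ y₀ y₁ y₂ y₃, I y₀ y₁ y₂ y₃ → ∃ p₀ p₁ p q, Preserves I g a' p₀ p₁ p q ∧
    p₀ * x₀ = y₀ ∧ p₁ * x₁ = y₁ ∧ p * x₂ - a' * q * x₃ = y₂ ∧ p * x₃ + g * q * x₂ = y₃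

/-- Every unit mod 4 is its own inverse. -/
lemma four_dvd_sub_of_mul_emod {g a' : ℤ} (h : g * a' % 4 = 1) : 4 ∣ a' - g := by
  have h1 : g % 4 = 0 ∨ g % 4 = 1 ∨ g % 4 = 2 ∨ g % 4 = 3 := by omega
  have h2 : a' % 4 = 0 ∨ a' % 4 = 1 ∨ a' % 4 = 2 ∨ a' % 4 = 3 := by omega
  rw [Int.mul_emod] at h
  rcases h1 with h1 | h1 | h1 | h1 <;> rcases h2 with h2 | h2 | h2 | h2 <;>
    simp only [h1, h2] at h <;> omega

lemma odd_of_mul_emod_four {g a' : ℤ} (h : g * a' % 4 = 1) : Odd g :=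
  (Int.odd_mul.1 (Int.odd_iff.2 (by omega : g * a' % 2 = 1))).1

lemma quarterLattice_zero_zero {g : ℤ} (hg : Odd g) (z w : ℚ) :
    QuarterLattice g 0 0 z w ↔ ∃ m n : ℤ, z = m / 2 ∧ w = n / 2 ∧ 2 ∣ n - m := by
  obtain ⟨k, rfl⟩ := hg
  constructor
  · rintro ⟨n₀, n₁, n₂, n₃, h0, h1, rfl, rfl, d1, d2, d3, d4⟩
    have h0 : n₀ = 0 := by
      have : (n₀ : ℚ) = 0 := by linarith
      exact_mod_cast this
    have h1 : n₁ = 0 := by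
      have : (n₁ : ℚ) = 0 := by linarith
      exact_mod_cast this
    subst h0 h1
    obtain ⟨m, hm⟩ := d2
    obtain ⟨n, hn⟩ := d3
    obtain ⟨e, he⟩ := d4
    obtain rfl : n₂ = 2 * m := by omega
    obtain rfl : n₃ = 2 * n := by omega
    exact ⟨m, n, by push_cast; ring, by push_cast; ring,
      ⟨e - m - k * n, by linarith only [he]⟩⟩
  · rintro ⟨m, n, rfl, rfl, ⟨e, he⟩⟩
    refine ⟨0, 0, 2 * m, 2 * n, by simp, by simp, by push_cast; ring, by push_cast; ring,
      by simp, by simp, by simp, ⟨m + e + k * n, ?_⟩⟩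
    linear_combination 2 * he

lemma halfLattice_zero_zero (z w : ℚ) :
    HalfLattice 0 0 z w ↔ ∃ m n : ℤ, z = m / 2 ∧ w = n / 2 ∧ 2 ∣ n - m := by
  constructor
  · rintro ⟨n₀, n₁, n₂, n₃, h0, h1, h2, h3, d1, d2⟩
    exact ⟨n₂, n₃, h2, h3, d2⟩
  · rintro ⟨m, n, h2, h3, d⟩
    exact ⟨0, 0, m, n, by simp, by simp, h2, h3, by simp, d⟩

/-- A multiplier also preserves the slice where the first two coordinates vanish, and by `hI` this
slice is the same for both shapes of lattice. Its vectors (1, 0), (0, 1) and (1/2, 1/2) suffice to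
force integrality. -/
lemma Preserves.isInt {I : ℚ → ℚ → ℚ → ℚ → Prop} {g a' : ℤ} {p₀ p₁ p q : ℚ}
    (h : Preserves I g a' p₀ p₁ p q)
    (hI : ∀ z w : ℚ, I 0 0 z w ↔ ∃ m n : ℤ, z = m / 2 ∧ w = n / 2 ∧ 2 ∣ n - m)
    (hc : IsCoprime g a') (h4 : g * a' % 4 = 1) : ∃ P Q : ℤ, p = P ∧ q = Q := by
  have e1 := h 0 0 1 0 ((hI _ _).2 ⟨2, 0, by norm_num, by norm_num, by norm_num⟩)
  have e2 := h 0 0 0 1 ((hI _ _).2 ⟨0, 2, by norm_num, by norm_num, by norm_num⟩)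
  have e3 := h 0 0 (1 / 2) (1 / 2) ((hI _ _).2 ⟨1, 1, by norm_num, by norm_num, by norm_num⟩)
  simp only [mul_zero, hI] at e1 e2 e3
  obtain ⟨m, n, hm, hn, d⟩ := e1
  obtain ⟨m', n', hm', hn', -⟩ := e2
  obtain ⟨r, s, hr, hs, d'⟩ := e3
  obtain ⟨u, v, huv⟩ := hc
  have huv' : (u : ℚ) * g + v * a' = 1 := by exact_mod_cast huv
  -- The images of (1, 0) and (0, 1) make 2gq and 2a'q integers; Bézout for g and a' then makes 2q
  -- an integer.
  set Q := u * n - v * m' with hQ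
  have hq : 2 * q = Q := by
    rw [hQ]; push_cast
    linear_combination (-2 * q) * huv' + 2 * u * hn - 2 * v * hm'
  have hgQ : g * Q = n := by
    have : (g : ℚ) * Q = n := by rw [← hq]; linear_combination 2 * hn
    exact_mod_cast this
  have hr' : m - a' * Q = 2 * r := by
    have : (m : ℚ) - a' * Q = 2 * r := by rw [← hq]; linear_combination 4 * hr - 2 * hm
    exact_mod_cast this
  have hs' : m + g * Q = 2 * s := by
    have : (m : ℚ) + g * Q = 2 * s := by rw [← hq]; linear_combination 4 * hs - 2 * hm
    exact_mod_cast this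
  obtain ⟨k, hk⟩ := four_dvd_sub_of_mul_emod h4
  obtain ⟨i, hi⟩ := odd_of_mul_emod_four h4
  have ha' : a' = 4 * k + 2 * i + 1 := by omega
  -- The left side is (g + a')Q, with g + a' ≡ 2 mod 4, while s - r is even; hence Q is even.
  have h5 : 2 * (s - r) = 4 * (k * Q + i * Q) + 2 * Q := by
    rw [ha'] at hr'; rw [hi] at hs'; linear_combination hr' - hs'
  obtain ⟨Q', hQ'⟩ : 2 ∣ Q := by omega
  have hmQ : (2 : ℤ) ∣ m := by
    have : n = 2 * (g * Q') := by rw [← hgQ, hQ']; ring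
    omega
  obtain ⟨P, hP⟩ := hmQ
  refine ⟨P, Q', ?_, ?_⟩
  · rw [hP] at hm; push_cast at hm; linarith
  · rw [hQ'] at hq; push_cast at hq; linarith

/-- A generator of a lattice whose projection to the last two coordinates is
`{(Z, W) / M | Z ≡ W mod 2}` has norm `± 2 / M²` there. -/
lemma Generates.norm_eq {I : ℚ → ℚ → ℚ → ℚ → Prop} {g a' : ℤ} {x₀ x₁ x₂ x₃ : ℚ}
    (h : Generates I g a' x₀ x₁ x₂ x₃) (hx : I x₀ x₁ x₂ x₃)
    (hI : ∀ z w : ℚ, I 0 0 z w ↔ ∃ m n : ℤ, z = m / 2 ∧ w = n / 2 ∧ 2 ∣ n - m)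
    (hc : IsCoprime g a') (h4 : g * a' % 4 = 1) {M : ℚ} (hM : M ≠ 0)
    (hproj : ∀ y₀ y₁ y₂ y₃, I y₀ y₁ y₂ y₃ → ∃ Z W : ℤ, y₂ = Z / M ∧ y₃ = W / M ∧ 2 ∣ W - Z)
    {u₀ u₁ v₀ v₁ : ℚ} (hu : I u₀ u₁ (2 / M) (0 / M)) {t : ℤ} (ht : IsUnit t)
    (hv : I v₀ v₁ (1 / M) (t / M)) :
    ∃ X Y : ℤ, g * X ^ 2 + a' * Y ^ 2 = 2 ∨ g * X ^ 2 + a' * Y ^ 2 = -2 := by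
  obtain ⟨X, Y, rfl, rfl, e, he⟩ := hproj _ _ _ _ hx
  refine ⟨X, Y, ?_⟩
  obtain ⟨_, _, p, q, hp, -, -, h1, h2⟩ := h _ _ _ _ hu
  obtain ⟨_, _, p', q', hp', -, -, h3, h4'⟩ := h _ _ _ _ hv
  obtain ⟨P, Q, rfl, rfl⟩ := hp.isInt hI hc h4
  obtain ⟨P', Q', rfl, rfl⟩ := hp'.isInt hI hc h4
  field_simp at h1 h2 h3 h4'
  norm_cast at h1 h2 h3 h4'
  -- The multipliers carry (X, Y) to (2, 0) and (1, t). These images have determinant 2t, which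
  -- factors as the determinant of the multipliers times the norm form.
  have key : (P * Q' - P' * Q) * (g * X ^ 2 + a' * Y ^ 2) = 2 * t := by
    have : 2 * t = (P * X - a' * Q * Y) * (P' * Y + X * Q' * g) -
        (P * Y + X * Q * g) * (P' * X - a' * Q' * Y) := by
      have a1 : P * X - a' * Q * Y = 2 := by linarith
      have a2 : P * Y + X * Q * g = 0 := by linarith
      have a3 : P' * X - a' * Q' * Y = 1 := by linarith
      have a4 : P' * Y + X * Q' * g = t := by linarith
      rw [a1, a2, a3, a4]; ring
    rw [this]; ring
  obtain ⟨i, hi⟩ := odd_of_mul_emod_four h4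
  obtain ⟨j, hj⟩ := odd_of_mul_emod_four (by rwa [mul_comm] at h4 : a' * g % 4 = 1)
  obtain ⟨f, hf⟩ : 2 ∣ g * X ^ 2 + a' * Y ^ 2 := by
    rw [show Y = X + 2 * e by omega, hi, hj]
    exact ⟨(i + j + 1) * X ^ 2 + (2 * j + 1) * (2 * X * e + 2 * e ^ 2), by ring⟩
  have hfu : IsUnit f := by
    refine isUnit_of_dvd_unit ⟨P * Q' - P' * Q, ?_⟩ ht
    rw [hf] at key
    linarith
  rcases Int.isUnit_iff.1 hfu with h | h <;> rw [hf, h] <;> simp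

lemma HalfLattice.exists_generates {g a' : ℤ} (h4 : g * a' % 4 = 1) {X Y N : ℤ}
    (hN : N = 2 ∨ N = -2) (hXY : g * X ^ 2 + a' * Y ^ 2 = N) (hX : Odd X) (hY : Odd Y) :
    HalfLattice (1 / 2) (1 / 2) (X / 2) (Y / 2) ∧
      Generates HalfLattice g a' (1 / 2) (1 / 2) (X / 2) (Y / 2) := by
  obtain ⟨i, hi⟩ := hX
  obtain ⟨j, hj⟩ := hY
  obtain ⟨k, hk⟩ := odd_of_mul_emod_four h4
  obtain ⟨l, hl⟩ := odd_of_mul_emod_four (by rwa [mul_comm] at h4 : a' * g % 4 = 1)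
  have hN0 : (N : ℚ) ≠ 0 := by rcases hN with rfl | rfl <;> norm_num
  have hXY' : (g : ℚ) * X ^ 2 + a' * Y ^ 2 = N := by exact_mod_cast hXY
  refine ⟨⟨1, 1, X, Y, by simp, by simp, rfl, rfl, by simp, by omega⟩, ?_⟩
  rintro _ _ _ _ ⟨m₀, m₁, m₂, m₃, rfl, rfl, rfl, rfl, d1, d2⟩
  obtain ⟨e, he⟩ := d2
  have he' : m₃ = m₂ + 2 * e := by omega
  -- Cramer's rule for (P + Qω)(X, Y) = (m₂, m₃), whose determinant is N. Both numerators are even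
  -- because X, Y, g, a' are odd and m₂ ≡ m₃ mod 2.
  obtain ⟨P, hP⟩ : N ∣ g * X * m₂ + a' * Y * m₃ := by
    have : 2 ∣ g * X * m₂ + a' * Y * m₃ := by
      rw [hk, hl, hi, hj, he']
      exact ⟨(k + l + i + j + 1 + 2 * k * i + 2 * l * j) * m₂ + (2 * l + 1) * (2 * j + 1) * e,
        by ring⟩
    rcases hN with rfl | rfl
    · exact this
    · exact (neg_dvd).2 this
  obtain ⟨Q, hQ⟩ : N ∣ X * m₃ - Y * m₂ := by
    have : 2 ∣ X * m₃ - Y * m₂ := by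
      rw [hi, hj, he']
      exact ⟨(i - j) * m₂ + (2 * i + 1) * e, by ring⟩
    rcases hN with rfl | rfl
    · exact this
    · exact (neg_dvd).2 this
  have hP' : (g : ℚ) * X * m₂ + a' * Y * m₃ = N * P := by exact_mod_cast hP
  have hQ' : (X : ℚ) * m₃ - Y * m₂ = N * Q := by exact_mod_cast hQ
  refine ⟨m₀, m₁, P, Q, ?_, by ring, by ring, ?_, ?_⟩
  · rintro _ _ _ _ ⟨n₀, n₁, n₂, n₃, rfl, rfl, rfl, rfl, ⟨c1, hc1⟩, ⟨c2, hc2⟩⟩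
    refine ⟨m₀ * n₀, m₁ * n₁, P * n₂ - a' * Q * n₃, P * n₃ + g * Q * n₂, by push_cast; ring,
      by push_cast; ring, by push_cast; ring, by push_cast; ring, ?_, ?_⟩
    · obtain ⟨c, hc⟩ := d1
      rw [show m₁ = m₀ + 2 * c by omega, show n₁ = n₀ + 2 * c1 by omega]
      exact ⟨m₀ * c1 + c * n₀ + 2 * c * c1, by ring⟩
    · rw [hl, hk, show n₃ = n₂ + 2 * c2 by omega]
      exact ⟨P * c2 + (k + l + 1) * Q * n₂ + (2 * l + 1) * Q * c2, by ring⟩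
  · have : (N : ℚ) * (P * (X / 2) - a' * Q * (Y / 2)) = N * (m₂ / 2) := by
      linear_combination (-X / 2 : ℚ) * hP' + (a' * Y / 2 : ℚ) * hQ' + (m₂ / 2 : ℚ) * hXY'
    exact mul_left_cancel₀ hN0 this
  · have : (N : ℚ) * (P * (Y / 2) + g * Q * (X / 2)) = N * (m₃ / 2) := by
      linear_combination (-Y / 2 : ℚ) * hP' - (g * X / 2 : ℚ) * hQ' + (m₃ / 2 : ℚ) * hXY'
    exact mul_left_cancel₀ hN0 this

/-- Mod 4 one has g² ≡ 1 and a' ≡ g, so the new value of the last congruence is p₀n₀ + p₁n₁ + p(n₂ +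
gn₃) + q(n₂ - gn₃). Replacing n₂ + gn₃ by -n₀ - n₁ reduces it to the stated conditions. -/
lemma QuarterLattice.preserves {g a' : ℤ} (h4 : g * a' % 4 = 1) {p₀ p₁ p q : ℤ}
    (h1 : 2 ∣ p₁ - p₀) (h2 : 2 ∣ p₀ + p + q) (h3 : 4 ∣ p₀ + p₁ + 2 * p) :
    Preserves (QuarterLattice g) g a' p₀ p₁ p q := by
  obtain ⟨k, hk⟩ := four_dvd_sub_of_mul_emod h4
  obtain ⟨i, hi⟩ := odd_of_mul_emod_four h4
  obtain rfl : a' = g + 4 * k := by omega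
  subst hi
  obtain ⟨c1, hc1⟩ := h1
  obtain ⟨c2, hc2⟩ := h2
  obtain ⟨c3, hc3⟩ := h3
  rintro _ _ _ _ ⟨n₀, n₁, n₂, n₃, rfl, rfl, rfl, rfl, ⟨e1, he1⟩, ⟨e2, he2⟩, ⟨e3, he3⟩, ⟨e4, he4⟩⟩
  refine ⟨p₀ * n₀, p₁ * n₁, p * n₂ - (2 * i + 1 + 4 * k) * q * n₃, p * n₃ + (2 * i + 1) * q * n₂,
    by push_cast; ring, by push_cast; ring, by push_cast; ring, by push_cast; ring, ?_, ?_, ?_, ?_⟩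
  · rw [show p₁ = p₀ + 2 * c1 by omega, show n₁ = n₀ + 2 * e1 by omega]
    exact ⟨p₀ * e1 + c1 * n₀ + 2 * c1 * e1, by ring⟩
  · rw [show n₂ = n₀ + 2 * e2 by omega, show n₃ = n₀ + 2 * e3 by omega,
      show p = 2 * c2 - p₀ - q by omega]
    exact ⟨c2 * n₀ - p₀ * n₀ - q * n₀ + (2 * c2 - p₀ - q) * e2 - (i + 2 * k) * q * n₀
      - (2 * i + 1 + 4 * k) * q * e3, by ring⟩
  · rw [show n₂ = n₀ + 2 * e2 by omega, show n₃ = n₀ + 2 * e3 by omega,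
      show p = 2 * c2 - p₀ - q by omega]
    exact ⟨c2 * n₀ - p₀ * n₀ + (2 * c2 - p₀ - q) * e3 + i * q * n₀
      + (2 * i + 1) * q * e2, by ring⟩
  · obtain rfl : n₁ = n₀ + 2 * e1 := by omega
    obtain rfl : n₂ = n₀ + 2 * e2 := by omega
    obtain rfl : p₁ = p₀ + 2 * c1 := by omega
    obtain rfl : p₀ = 2 * c2 - p - q := by omega
    refine ⟨p * e4 + q * ((i ^ 2 + i) * (n₀ + 2 * e2) - e4 - k * n₃) + n₀ * (c3 - p + q) +
      e1 * (c1 + c2 - p) + q * e2, ?_⟩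
    linear_combination (p - q) * he4 + n₀ * hc3

lemma QuarterLattice.exists_generates {g a' : ℤ} (h4 : g * a' % 4 = 1) {X Y N : ℤ}
    (hN : N = 2 ∨ N = -2) (hXY : g * X ^ 2 + a' * Y ^ 2 = N) (hX : Odd X) (hY : Odd Y) :
    ∃ y : ℤ, y ^ 2 = 1 ∧ QuarterLattice g (1 / 4) (y / 4) (X / 4) (Y / 4) ∧
      Generates (QuarterLattice g) g a' (1 / 4) (y / 4) (X / 4) (Y / 4) := by
  obtain ⟨i, hi⟩ := hX
  obtain ⟨j, hj⟩ := hY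
  obtain ⟨k, hk⟩ := odd_of_mul_emod_four h4
  obtain ⟨l, hl⟩ := four_dvd_sub_of_mul_emod h4
  have hN0 : (N : ℚ) ≠ 0 := by rcases hN with rfl | rfl <;> norm_num
  have hXY' : (g : ℚ) * X ^ 2 + a' * Y ^ 2 = N := by exact_mod_cast hXY
  -- 1 + X + gY is odd, so exactly one sign y makes (1, y, X, Y)/4 satisfy the mod 4 condition of
  -- the lattice.
  obtain ⟨y, hy, r, hr⟩ : ∃ y : ℤ, y ^ 2 = 1 ∧ 4 ∣ 1 + y + X + g * Y := by
    rcases Int.even_or_odd' (i + j + k + 2 * k * j) with ⟨c, hc | hc⟩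
    · exact ⟨1, by norm_num, c + 1, by rw [hi, hj, hk]; linear_combination 2 * hc⟩
    · exact ⟨-1, by norm_num, c + 1, by rw [hi, hj, hk]; linear_combination 2 * hc⟩
  have hy' : (y : ℚ) ^ 2 = 1 := by exact_mod_cast hy
  obtain ⟨y', hyy⟩ : 2 ∣ y - 1 := by
    rcases eq_or_eq_neg_of_sq_eq_sq y 1 (by rw [hy, one_pow]) with rfl | rfl <;> norm_num
  refine ⟨y, hy, ⟨1, y, X, Y, by simp, rfl, rfl, rfl, ⟨y', hyy⟩, by omega, by omega, r, hr⟩, ?_⟩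
  rintro _ _ _ _ ⟨m₀, m₁, m₂, m₃, rfl, rfl, rfl, rfl, ⟨e1, he1⟩, ⟨e2, he2⟩, ⟨e3, he3⟩, ⟨e4, he4⟩⟩
  obtain ⟨P, hP⟩ : N ∣ g * X * m₂ + a' * Y * m₃ := by
    have : 2 ∣ g * X * m₂ + a' * Y * m₃ := by
      rw [show a' = g + 4 * l by omega, hk, hi, hj, show m₂ = m₀ + 2 * e2 by omega,
        show m₃ = m₀ + 2 * e3 by omega]
      exact ⟨(2 * k + 1) * (2 * i + 1) * e2 + (2 * k + 1 + 4 * l) * (2 * j + 1) * e3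
        + m₀ * ((2 * k + 1) * (i + j + 1) + 2 * l * (2 * j + 1)), by ring⟩
    rcases hN with rfl | rfl
    · exact this
    · exact (neg_dvd).2 this
  obtain ⟨Q, hQ⟩ : N ∣ X * m₃ - Y * m₂ := by
    have : 2 ∣ X * m₃ - Y * m₂ := by
      rw [hi, hj, show m₂ = m₀ + 2 * e2 by omega, show m₃ = m₀ + 2 * e3 by omega]
      exact ⟨(i - j) * m₀ + (2 * i + 1) * e3 - (2 * j + 1) * e2, by ring⟩
    rcases hN with rfl | rfl
    · exact this
    · exact (neg_dvd).2 this
  have hP' : (g : ℚ) * X * m₂ + a' * Y * m₃ = N * P := by exact_mod_cast hP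
  have hQ' : (X : ℚ) * m₃ - Y * m₂ = N * Q := by exact_mod_cast hQ
  have E2 : (P : ℚ) * X - a' * Q * Y = m₂ := by
    have : (N : ℚ) * (P * X - a' * Q * Y) = N * m₂ := by
      linear_combination (-X : ℚ) * hP' + (a' * Y : ℚ) * hQ' + (m₂ : ℚ) * hXY'
    exact mul_left_cancel₀ hN0 this
  have E3 : (P : ℚ) * Y + g * Q * X = m₃ := by
    have : (N : ℚ) * (P * Y + g * Q * X) = N * m₃ := by
      linear_combination (-Y : ℚ) * hP' - (g * X : ℚ) * hQ' + (m₃ : ℚ) * hXY'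
    exact mul_left_cancel₀ hN0 this
  have E2' : P * X - a' * Q * Y = m₂ := by exact_mod_cast E2
  have E3' : P * Y + g * Q * X = m₃ := by exact_mod_cast E3
  obtain ⟨S, hS⟩ : ∃ S, P + Q = m₂ + 2 * S := by
    refine ⟨Q * (k + 2 * l + j + 2 * j * (k + 2 * l) + 1) - P * i, ?_⟩
    rw [← E2', show a' = g + 4 * l by omega, hk, hi, hj]
    ring
  -- The second component is y m₁ because y is its own inverse.
  refine ⟨m₀, (y * m₁ : ℤ), P, Q, QuarterLattice.preserves h4 ?_ ?_ ?_, by ring, ?_, ?_, ?_⟩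
  · rw [show y = 1 + 2 * y' by omega, show m₁ = m₀ + 2 * e1 by omega]
    exact ⟨e1 + y' * m₀ + 2 * y' * e1, by ring⟩
  · omega
  -- The mod 4 condition on the target, rewritten in P and Q. The generator's condition gives X + gY
  -- ≡ -1 - y, and g²X - a'Y ≡ 2X - (X + gY) ≡ 2 + 1 + y. For y = -1 the parity of P + Q is needed
  -- as well.
  · have h5 : P * (X + g * Y) + Q * (g ^ 2 * X - a' * Y) = 4 * e4 - m₀ - m₁ := by
      linear_combination E2' + g * E3' + he4
    have h6 : X + g * Y = 4 * r - 1 - y := by omega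
    have h7 : g ^ 2 * X - a' * Y = 2 * (2 * i + 1) - 4 * r + 1 + y +
        4 * ((k ^ 2 + k) * X - l * Y) := by
      rw [show a' = g + 4 * l by omega]
      linear_combination 2 * hi - h6 + X * (g + 2 * k + 1) * hk
    rw [h6, h7] at h5
    rcases eq_or_eq_neg_of_sq_eq_sq y 1 (by rw [hy, one_pow]) with rfl | rfl
    · exact ⟨e4 + P - P * r - Q * (i + 1 - r + ((k ^ 2 + k) * X - l * Y)),
        by linear_combination h5⟩
    · refine ⟨e4 - P * r - Q * (i - r + ((k ^ 2 + k) * X - l * Y)) + (e2 - e1 + S - Q), ?_⟩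
      linear_combination h5 + 2 * hS + 2 * he2 - 2 * he1
  · push_cast
    linear_combination (m₁ / 4 : ℚ) * hy'
  · linear_combination E2 / 4
  · linear_combination E3 / 4


/-- As g and a' are odd, two even arguments give a multiple of 4 and arguments of opposite parity
give an odd number. -/
lemma odd_of_mul_sq_add_mul_sq {g a' X Y N : ℤ} (h4 : g * a' % 4 = 1) (hN : N = 2 ∨ N = -2)
    (hXY : g * X ^ 2 + a' * Y ^ 2 = N) : Odd X ∧ Odd Y := by
  obtain ⟨k, hk⟩ := odd_of_mul_emod_four h4
  obtain ⟨l, hl⟩ := odd_of_mul_emod_four (by rwa [mul_comm] at h4 : a' * g % 4 = 1)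
  rcases Int.even_or_odd' X with ⟨i, hi | hi⟩ <;> rcases Int.even_or_odd' Y with ⟨j, hj | hj⟩
  · exfalso
    have : N = 4 * (g * i ^ 2 + a' * j ^ 2) := by rw [← hXY, hi, hj]; ring
    omega
  · exfalso
    have : N = 2 * (g * 2 * i ^ 2 + 2 * a' * (j ^ 2 + j) + l) + 1 := by
      rw [← hXY, hi, hj, hl]; ring
    omega
  · exfalso
    have : N = 2 * (a' * 2 * j ^ 2 + 2 * g * (i ^ 2 + i) + k) + 1 := by
      rw [← hXY, hi, hj, hk]; ring
    omega
  · exact ⟨⟨i, hi⟩, ⟨j, hj⟩⟩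

/-- Either equation makes g divide x², hence x since g is squarefree; substitute x = gX and cancel
g. -/
lemma exists_sq_add_mul_sq_iff {g a' : ℤ} (hg : g ≠ 0) (hsq : Squarefree (g * a')) :
    (∃ x y : ℤ, x ^ 2 + g * a' * y ^ 2 = 2 * g ∨ x ^ 2 + g * a' * y ^ 2 = -(2 * g)) ↔
      ∃ X Y : ℤ, g * X ^ 2 + a' * Y ^ 2 = 2 ∨ g * X ^ 2 + a' * Y ^ 2 = -2 := by
  constructor
  · rintro ⟨x, y, h⟩
    obtain ⟨X, rfl⟩ : g ∣ x := by
      rw [← (hsq.of_mul_left).dvd_pow_iff_dvd two_ne_zero]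
      rcases h with h | h
      · exact ⟨2 - a' * y ^ 2, by linear_combination h⟩
      · exact ⟨-2 - a' * y ^ 2, by linear_combination h⟩
    refine ⟨X, y, h.imp (fun h => ?_) fun h => ?_⟩ <;> apply mul_left_cancel₀ hg <;>
      linear_combination h
  · rintro ⟨X, Y, h⟩
    refine ⟨g * X, Y, h.imp (fun h => ?_) fun h => ?_⟩ <;> linear_combination g * h

lemma QuarterLattice.norm_eq {g a' : ℤ} (h4 : g * a' % 4 = 1) (hc : IsCoprime g a')
    {x₀ x₁ x₂ x₃ : ℚ} (hx : QuarterLattice g x₀ x₁ x₂ x₃)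
    (h : Generates (QuarterLattice g) g a' x₀ x₁ x₂ x₃) :
    ∃ X Y : ℤ, g * X ^ 2 + a' * Y ^ 2 = 2 ∨ g * X ^ 2 + a' * Y ^ 2 = -2 := by
  have hg := odd_of_mul_emod_four h4
  -- The sign t ≡ g mod 4 puts (1, 1, 1, t)/4 in the lattice; together with (2, 0, 2, 0)/4 it spans
  -- the projection to the last two coordinates.
  obtain ⟨t, ht, hgt⟩ : ∃ t : ℤ, IsUnit t ∧ 4 ∣ 3 + g * t := by
    rcases (by obtain ⟨k, hk⟩ := hg; omega : g % 4 = 1 ∨ g % 4 = 3) with hg | hg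
    · exact ⟨1, isUnit_one, by omega⟩
    · exact ⟨-1, isUnit_one.neg, by omega⟩
  refine h.norm_eq hx (quarterLattice_zero_zero hg) hc h4 (M := 4) (by norm_num) ?_
    (u₀ := 2 / 4) (u₁ := 0 / 4) ⟨2, 0, 2, 0, by norm_num, by norm_num, by norm_num, by norm_num,
      by norm_num, by norm_num, by norm_num, by norm_num⟩ (v₀ := 1 / 4) (v₁ := 1 / 4) ht
    ⟨1, 1, 1, t, by norm_num, by norm_num, by norm_num, by norm_num,
      by norm_num, by norm_num, ?_, by omega⟩
  · rintro _ _ _ _ ⟨n₀, n₁, n₂, n₃, -, -, rfl, rfl, -, h2, h3, -⟩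
    exact ⟨n₂, n₃, rfl, rfl, by omega⟩
  · rcases Int.isUnit_iff.1 ht with rfl | rfl <;> norm_num

lemma HalfLattice.norm_eq {g a' : ℤ} (h4 : g * a' % 4 = 1) (hc : IsCoprime g a')
    {x₀ x₁ x₂ x₃ : ℚ} (hx : HalfLattice x₀ x₁ x₂ x₃)
    (h : Generates HalfLattice g a' x₀ x₁ x₂ x₃) :
    ∃ X Y : ℤ, g * X ^ 2 + a' * Y ^ 2 = 2 ∨ g * X ^ 2 + a' * Y ^ 2 = -2 := by
  refine h.norm_eq hx halfLattice_zero_zero hc h4 (M := 2) (by norm_num) ?_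
    (u₀ := 0) (u₁ := 0) ⟨0, 0, 2, 0, by norm_num, by norm_num, by norm_num, by norm_num,
      by norm_num, by norm_num⟩ (v₀ := 0) (v₁ := 0) isUnit_one
    ⟨0, 0, 1, 1, by norm_num, by norm_num, by norm_num, by norm_num, by norm_num, by norm_num⟩
  rintro _ _ _ _ ⟨n₀, n₁, n₂, n₃, -, -, rfl, rfl, -, h2⟩
  exact ⟨n₂, n₃, rfl, rfl, h2⟩

/-! ### Rings of integers of quadratic and biquadratic fields -/

lemma isIntegral_int_ratCast {L : Type*} [Field L] [CharZero L] {q : ℚ}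
    (h : IsIntegral ℤ (q : L)) : ∃ n : ℤ, q = n := by
  have h' : IsIntegral ℤ (algebraMap ℚ L q) := by simpa using h
  rw [isIntegral_algebraMap_iff (algebraMap ℚ L).injective] at h'
  obtain ⟨n, hn⟩ := IsIntegrallyClosed.isIntegral_iff.1 h'
  exact ⟨n, by simpa using hn.symm⟩

lemma IsIntegral.of_eq {L : Type*} [Ring L] {u v : L} (hu : IsIntegral ℤ u) (h : v = u) :
    IsIntegral ℤ v := h ▸ hu

lemma isIntegral_half_one_add {L : Type*} [Field L] [CharZero L] {d : ℤ} {s : L}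
    (hs : s ^ 2 = d) (hd : d % 4 = 1) : IsIntegral ℤ ((1 + s) / 2) := by
  obtain ⟨k, hk⟩ : 4 ∣ d - 1 := by omega
  obtain rfl : d = 4 * k + 1 := by omega
  refine ⟨Polynomial.X ^ 2 - Polynomial.X - Polynomial.C k, by monicity!, ?_⟩
  push_cast at hs
  simp only [Polynomial.eval₂_sub, Polynomial.eval₂_pow, Polynomial.eval₂_X, Polynomial.eval₂_C,
    algebraMap_int_eq]
  rw [eq_intCast]
  linear_combination hs / 4

/-- A rational number whose square times a squarefree integer is an integer is an integer. -/
lemma Squarefree.exists_int_of_mul_sq {d : ℤ} (hd : Squarefree d) {y : ℚ} {m : ℤ}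
    (h : d * y ^ 2 = m) : ∃ n : ℤ, y = n := by
  have hden : (y.den : ℚ) ≠ 0 := by exact_mod_cast y.den_nz
  have h1 : d * y.num ^ 2 = m * (y.den : ℤ) ^ 2 := by
    have : (d : ℚ) * y.num ^ 2 = m * (y.den : ℚ) ^ 2 := by
      rw [← h]
      nth_rw 2 [← Rat.num_div_den y]
      field_simp
    exact_mod_cast this
  have hcop : IsCoprime ((y.den : ℤ) ^ 2) (y.num ^ 2) :=
    (Rat.isCoprime_num_den y).symm.pow
  -- The squared denominator is prime to the squared numerator, so it divides d, which is
  -- squarefree.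
  have h2 : (y.den : ℤ) * y.den ∣ d := by
    rw [← sq]
    exact hcop.dvd_of_dvd_mul_right ⟨m, by rw [h1]; ring⟩
  have h3 : y.den = 1 := by
    simpa [Int.isUnit_iff_natAbs_eq] using hd _ h2
  exact ⟨y.num, by conv_lhs => rw [← Rat.num_div_den y, h3]; simp⟩

/-- Integers of `ℚ(√d)`, in the form: if `x ± y √d` are integral, then `2x`, `2y` are integers
with `(2x)² ≡ d (2y)² mod 4`. -/
lemma exists_two_mul_of_isIntegral {L : Type*} [Field L] [CharZero L] {d : ℤ}
    (hd : Squarefree d) {s : L} (hs : s ^ 2 = d) {x y : ℚ} (h1 : IsIntegral ℤ ((x : L) + y * s))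
    (h2 : IsIntegral ℤ ((x : L) - y * s)) :
    ∃ X Y : ℤ, 2 * x = X ∧ 2 * y = Y ∧ 4 ∣ X ^ 2 - d * Y ^ 2 := by
  -- Trace 2x and norm x² - dy² are integers, hence so is d(2y)².
  obtain ⟨X, hX⟩ := isIntegral_int_ratCast (L := L) (q := 2 * x) (by
    have h := h1.add h2
    rwa [show (x : L) + y * s + (x - y * s) = (2 * x : ℚ) by push_cast; ring] at h)
  obtain ⟨N, hN⟩ := isIntegral_int_ratCast (L := L) (q := x ^ 2 - d * y ^ 2) (by
    have h := h1.mul h2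
    rwa [show ((x : L) + y * s) * (x - y * s) = (x ^ 2 - d * y ^ 2 : ℚ) by
      push_cast; linear_combination (-y ^ 2 : L) * hs] at h)
  obtain ⟨Y, hY⟩ := hd.exists_int_of_mul_sq (y := 2 * y) (m := X ^ 2 - 4 * N) (by
    push_cast; rw [← hX]; linear_combination -4 * hN)
  refine ⟨X, Y, hX, hY, N, ?_⟩
  have : (X : ℚ) ^ 2 - d * Y ^ 2 = 4 * N := by rw [← hX, ← hY]; linear_combination 4 * hN
  exact_mod_cast this

lemma exists_two_mul_of_isIntegral_of_emod_eq_one {L : Type*} [Field L] [CharZero L] {d : ℤ}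
    (hd : Squarefree d) (hd4 : d % 4 = 1) {s : L} (hs : s ^ 2 = d) {x y : ℚ}
    (h1 : IsIntegral ℤ ((x : L) + y * s)) (h2 : IsIntegral ℤ ((x : L) - y * s)) :
    ∃ X Y : ℤ, 2 * x = X ∧ 2 * y = Y ∧ 2 ∣ Y - X := by
  obtain ⟨X, Y, hX, hY, k, hk⟩ := exists_two_mul_of_isIntegral hd hs h1 h2
  refine ⟨X, Y, hX, hY, ?_⟩
  obtain ⟨e, he⟩ : 4 ∣ d - 1 := by omega
  obtain rfl : d = 4 * e + 1 := by omega
  rcases Int.even_or_odd' X with ⟨i, hi | hi⟩ <;> rcases Int.even_or_odd' Y with ⟨j, hj | hj⟩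
  · omega
  · exfalso
    rw [hi, hj] at hk
    have : 4 * (i ^ 2 - (4 * e + 1) * (j ^ 2 + j) - e - k) = 1 := by linear_combination hk
    omega
  · exfalso
    rw [hi, hj] at hk
    have : 4 * (i ^ 2 + i - (4 * e + 1) * j ^ 2 - k) = -1 := by linear_combination hk
    omega
  · omega

lemma exists_of_isIntegral_of_emod_ne_one {L : Type*} [Field L] [CharZero L] {d : ℤ}
    (hd : Squarefree d) (hd4 : d % 4 ≠ 1) {s : L} (hs : s ^ 2 = d) {x y : ℚ}
    (h1 : IsIntegral ℤ ((x : L) + y * s)) (h2 : IsIntegral ℤ ((x : L) - y * s)) :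
    ∃ X Y : ℤ, x = X ∧ y = Y := by
  have hd0 : d % 4 ≠ 0 := fun h => by
    have := hd 2 (by omega)
    norm_num [Int.isUnit_iff] at this
  obtain ⟨X, Y, hX, hY, k, hk⟩ := exists_two_mul_of_isIntegral hd hs h1 h2
  have key : 2 ∣ X ∧ 2 ∣ Y := by
    rcases Int.even_or_odd' X with ⟨i, hi | hi⟩ <;> rcases Int.even_or_odd' Y with ⟨j, hj | hj⟩
    · omega
    · exfalso
      rw [hi, hj] at hk
      have : 4 * (i ^ 2 - d * (j ^ 2 + j) - k) = d := by linear_combination hk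
      omega
    · exfalso
      rw [hi, hj] at hk
      have : 4 * (i ^ 2 + i - d * j ^ 2 - k) = -1 := by linear_combination hk
      omega
    · exfalso
      rw [hi, hj] at hk
      have : 4 * (i ^ 2 + i - d * (j ^ 2 + j) - k) = d - 1 := by linear_combination hk
      omega
  obtain ⟨⟨i, hi⟩, ⟨j, hj⟩⟩ := key
  refine ⟨i, j, ?_, ?_⟩
  · rw [hi] at hX; push_cast at hX; linarith
  · rw [hj] at hY; push_cast at hY; linarith

/-- The element of `ℚ(√a, √b)` with the given coordinates with respect to `1, √a, √b, √c`. -/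
def biquadElem {L : Type*} [Field L] (sa sb sc : L) (x₀ x₁ x₂ x₃ : ℚ) : L :=
  x₀ + x₁ * sa + x₂ * sb + x₃ * sc

/-- `sa, sb, sc` are square roots of `g a'`, `g b'`, `a' b'` in a field having the four
automorphisms that change their signs, with `a = g a'` and `b = g b'` squarefree and
`a ≡ 1 mod 4`. -/
structure IsBiquadratic (L : Type*) [Field L] (g a' b' : ℤ) (sa sb sc : L) : Prop where
  sq_a : sa ^ 2 = g * a'
  sq_b : sb ^ 2 = g * b'
  mul_eq : sa * sb = g * sc
  squarefree_a : Squarefree (g * a')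
  squarefree_b : Squarefree (g * b')
  isCoprime : IsCoprime a' b'
  emod_four : g * a' % 4 = 1
  exists_aut : ∃ σ τ : L →+* L, σ sa = -sa ∧ σ sb = sb ∧ τ sa = sa ∧ τ sb = -sb

namespace IsBiquadratic

variable {L : Type*} [Field L] {g a' b' : ℤ} {sa sb sc : L}

lemma g_ne_zero (h : IsBiquadratic L g a' b' sa sb sc) : g ≠ 0 := by
  rintro rfl
  simpa using h.emod_four

lemma isCoprime_g (h : IsBiquadratic L g a' b' sa sb sc) : IsCoprime g a' :=
  (squarefree_mul_iff.1 h.squarefree_a).1.isCoprime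

lemma squarefree_c (h : IsBiquadratic L g a' b' sa sb sc) : Squarefree (a' * b') :=
  squarefree_mul_iff.2 ⟨h.isCoprime.isRelPrime, h.squarefree_a.of_mul_right,
    h.squarefree_b.of_mul_right⟩

/-- This is c ≡ b mod 4, so that √b and √c fall under the same case of the quadratic theory. -/
lemma emod_four_c (h : IsBiquadratic L g a' b' sa sb sc) : a' * b' % 4 = g * b' % 4 := by
  obtain ⟨k, hk⟩ := four_dvd_sub_of_mul_emod h.emod_four
  rw [show a' = g + 4 * k by omega, show (g + 4 * k) * b' = g * b' + 4 * (k * b') by ring]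
  omega

variable [CharZero L]

lemma g_cast_ne_zero (h : IsBiquadratic L g a' b' sa sb sc) : (g : L) ≠ 0 :=
  Int.cast_ne_zero.2 h.g_ne_zero

lemma sq_c (h : IsBiquadratic L g a' b' sa sb sc) : sc ^ 2 = a' * b' := by
  apply mul_left_cancel₀ (pow_ne_zero 2 h.g_cast_ne_zero)
  linear_combination -(sa * sb + g * sc) * h.mul_eq + sb ^ 2 * h.sq_a + (g * a') * h.sq_b

lemma sa_mul_sc (h : IsBiquadratic L g a' b' sa sb sc) : sa * sc = a' * sb := by
  apply mul_left_cancel₀ h.g_cast_ne_zero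
  linear_combination -sa * h.mul_eq + sb * h.sq_a

lemma sb_mul_sc (h : IsBiquadratic L g a' b' sa sb sc) : sb * sc = b' * sa := by
  apply mul_left_cancel₀ h.g_cast_ne_zero
  linear_combination -sb * h.mul_eq + sa * h.sq_b

lemma isIntegral_conj (h : IsBiquadratic L g a' b' sa sb sc) {x₀ x₁ x₂ x₃ : ℚ}
    (hx : IsIntegral ℤ (biquadElem sa sb sc x₀ x₁ x₂ x₃)) :
    IsIntegral ℤ (biquadElem sa sb sc x₀ (-x₁) x₂ (-x₃)) ∧
      IsIntegral ℤ (biquadElem sa sb sc x₀ x₁ (-x₂) (-x₃)) ∧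
      IsIntegral ℤ (biquadElem sa sb sc x₀ (-x₁) (-x₂) x₃) := by
  obtain ⟨σ, τ, h1, h2, h3, h4⟩ := h.exists_aut
  have h5 : σ sc = -sc := by
    apply mul_left_cancel₀ h.g_cast_ne_zero
    have := congrArg σ h.mul_eq
    simp only [map_mul, map_intCast, h1, h2] at this
    linear_combination -this - h.mul_eq
  have h6 : τ sc = -sc := by
    apply mul_left_cancel₀ h.g_cast_ne_zero
    have := congrArg τ h.mul_eq
    simp only [map_mul, map_intCast, h3, h4] at this
    linear_combination -this - h.mul_eq
  have hσ := hx.map (σ.toIntAlgHom)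
  have hτ := hx.map (τ.toIntAlgHom)
  have hστ := hτ.map (σ.toIntAlgHom)
  simp only [biquadElem] at hσ hτ hστ ⊢
  simp [h1, h2, h3, h4, h5, h6] at hσ hτ hστ
  refine ⟨?_, ?_, ?_⟩
  · simpa using hσ
  · simpa using hτ
  · simpa using hστ

/-- These are the relative traces to the three quadratic subfields and their conjugates, each a sum
of two conjugates of the given integer. -/
lemma isIntegral_pairs (h : IsBiquadratic L g a' b' sa sb sc) {x₀ x₁ x₂ x₃ : ℚ}
    (hx : IsIntegral ℤ (biquadElem sa sb sc x₀ x₁ x₂ x₃)) :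
    (IsIntegral ℤ (((2 * x₀ : ℚ) : L) + (2 * x₁ : ℚ) * sa) ∧
      IsIntegral ℤ (((2 * x₀ : ℚ) : L) - (2 * x₁ : ℚ) * sa)) ∧
    (IsIntegral ℤ (((2 * x₀ : ℚ) : L) + (2 * x₂ : ℚ) * sb) ∧
      IsIntegral ℤ (((2 * x₀ : ℚ) : L) - (2 * x₂ : ℚ) * sb)) ∧
    (IsIntegral ℤ (((2 * x₀ : ℚ) : L) + (2 * x₃ : ℚ) * sc) ∧
      IsIntegral ℤ (((2 * x₀ : ℚ) : L) - (2 * x₃ : ℚ) * sc)) := by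
  obtain ⟨hσ, hτ, hστ⟩ := h.isIntegral_conj hx
  have key : ∀ {u v w : L}, IsIntegral ℤ u → IsIntegral ℤ v → u + v = w → IsIntegral ℤ w :=
    fun hu hv huv => huv ▸ hu.add hv
  refine ⟨⟨key hx hτ ?_, key hσ hστ ?_⟩, ⟨key hx hσ ?_, key hτ hστ ?_⟩,
    key hx hστ ?_, key hσ hτ ?_⟩ <;> simp only [biquadElem] <;> push_cast <;> ring

theorem isIntegral_iff_quarter (h : IsBiquadratic L g a' b' sa sb sc) (hb : g * b' % 4 = 1)
    (x₀ x₁ x₂ x₃ : ℚ) :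
    IsIntegral ℤ (biquadElem sa sb sc x₀ x₁ x₂ x₃) ↔ QuarterLattice g x₀ x₁ x₂ x₃ := by
  have ia := isIntegral_half_one_add (s := sa) (d := g * a') (by push_cast; exact h.sq_a) h.emod_four
  have ib := isIntegral_half_one_add (s := sb) (d := g * b') (by push_cast; exact h.sq_b) hb
  have ic := isIntegral_half_one_add (s := sc) (d := a' * b') (by push_cast; exact h.sq_c)
    (h.emod_four_c.trans hb)
  have iab := ia.mul ib
  have int (n : ℤ) : IsIntegral ℤ (n : L) := isIntegral_algebraMap (x := n)
  obtain ⟨i, hi⟩ := odd_of_mul_emod_four h.emod_four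
  constructor
  · intro hx
    obtain ⟨⟨ha1, ha2⟩, ⟨hb1, hb2⟩, ⟨hc1, hc2⟩⟩ := h.isIntegral_pairs hx
    obtain ⟨n₀, n₁, h0, h1, e1⟩ := exists_two_mul_of_isIntegral_of_emod_eq_one h.squarefree_a
      h.emod_four (by push_cast; exact h.sq_a) ha1 ha2
    obtain ⟨n₀', n₂, h0', h2, e2⟩ := exists_two_mul_of_isIntegral_of_emod_eq_one h.squarefree_b
      hb (by push_cast; exact h.sq_b) hb1 hb2
    obtain ⟨n₀'', n₃, h0'', h3, e3⟩ := exists_two_mul_of_isIntegral_of_emod_eq_one h.squarefree_c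
      (h.emod_four_c.trans hb) (by push_cast; exact h.sq_c) hc1 hc2
    obtain rfl : n₀ = n₀' := by exact_mod_cast h0.symm.trans h0'
    obtain rfl : n₀ = n₀'' := by exact_mod_cast h0.symm.trans h0''
    refine ⟨n₀, n₁, n₂, n₃, by linarith, by linarith, by linarith, by linarith, e1, e2, e3, ?_⟩
    obtain rfl : x₀ = n₀ / 4 := by linarith
    obtain rfl : x₁ = n₁ / 4 := by linarith
    obtain rfl : x₂ = n₂ / 4 := by linarith
    obtain rfl : x₃ = n₃ / 4 := by linarith
    obtain ⟨k₁, hk₁⟩ := e1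
    obtain ⟨k₂, hk₂⟩ := e2
    obtain ⟨k₃, hk₃⟩ := e3
    obtain rfl : n₁ = n₀ + 2 * k₁ := by omega
    obtain rfl : n₂ = n₀ + 2 * k₂ := by omega
    obtain rfl : n₃ = n₀ + 2 * k₃ := by omega
    -- Subtracting multiples of (1+√a)(1+√b)/4 and of the three (1+√d)/2 kills all irrational
    -- coordinates. The shift i n₀ appears because √a√b = (2i+1)√c. The remainder is an integral
    -- rational, which is the mod 4 condition.
    have hsum := ((((hx.sub ((int n₀).mul iab)).sub ((int k₁).mul ia)).sub ((int k₂).mul ib)).sub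
      ((int (k₃ - i * n₀)).mul ic))
    obtain ⟨m, hm⟩ := isIntegral_int_ratCast (L := L) (q := -(k₁ + k₂ + (k₃ - i * n₀)) / 2) (by
      refine hsum.of_eq ?_
      simp only [biquadElem]
      have hg : (g : L) = 2 * i + 1 := by rw [hi]; push_cast; ring
      push_cast
      linear_combination (n₀ / 4 : L) * h.mul_eq + (n₀ / 4 * sc : L) * hg)
    have hm' : -(k₁ + k₂ + (k₃ - i * n₀)) = 2 * m := by
      have : (-(k₁ + k₂ + (k₃ - i * n₀)) : ℚ) = 2 * m := by linarith
      exact_mod_cast this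
    refine ⟨n₀ - m + i * k₃ + i * n₀, ?_⟩
    rw [hi]
    linear_combination -2 * hm'
  · rintro ⟨n₀, n₁, n₂, n₃, rfl, rfl, rfl, rfl, ⟨k₁, hk₁⟩, ⟨k₂, hk₂⟩, ⟨k₃, hk₃⟩, ⟨r, hr⟩⟩
    obtain rfl : n₁ = n₀ + 2 * k₁ := by omega
    obtain rfl : n₂ = n₀ + 2 * k₂ := by omega
    obtain rfl : n₃ = n₀ + 2 * k₃ := by omega
    have hsum := (((((int n₀).mul iab).add ((int k₁).mul ia)).add ((int k₂).mul ib)).add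
      ((int (k₃ - i * n₀)).mul ic)).add (int (n₀ + i * k₃ + i * n₀ - r))
    have hr' : (n₀ + (n₀ + 2 * k₁) + (n₀ + 2 * k₂) + g * (n₀ + 2 * k₃) : L) = 4 * r := by
      exact_mod_cast hr
    refine hsum.of_eq ?_
    simp only [biquadElem]
    have hg : (g : L) = 2 * i + 1 := by rw [hi]; push_cast; ring
    push_cast
    linear_combination (-n₀ / 4 : L) * h.mul_eq - (n₀ / 4 * sc : L) * hg - hr' / 4 +
      ((n₀ + 2 * k₃) / 4 : L) * hg

theorem isIntegral_iff_half (h : IsBiquadratic L g a' b' sa sb sc) (hb : g * b' % 4 ≠ 1)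
    (x₀ x₁ x₂ x₃ : ℚ) :
    IsIntegral ℤ (biquadElem sa sb sc x₀ x₁ x₂ x₃) ↔ HalfLattice x₀ x₁ x₂ x₃ := by
  have ia := isIntegral_half_one_add (s := sa) (d := g * a') (by push_cast; exact h.sq_a) h.emod_four
  have int (n : ℤ) : IsIntegral ℤ (n : L) := isIntegral_algebraMap (x := n)
  obtain ⟨i, hi⟩ := odd_of_mul_emod_four h.emod_four
  obtain ⟨k, hk⟩ := four_dvd_sub_of_mul_emod h.emod_four
  have ib : IsIntegral ℤ sb := by
    refine IsIntegral.of_pow two_pos ?_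
    rw [h.sq_b]
    exact (int g).mul (int b')
  -- The square is b'(g + a' + 2√a)/4, and g + a' = 2 + 4(i + k), which gives b'(1+√a)/2 + b'(i +
  -- k).
  have ibc : IsIntegral ℤ ((sb + sc) / 2) := by
    refine IsIntegral.of_pow two_pos ?_
    refine (((int b').mul ia).add (int (b' * (i + k)))).of_eq ?_
    have ha : (a' : L) = g + 4 * k := by rw [show a' = g + 4 * k by omega]; push_cast; ring
    have hg : (g : L) = 2 * i + 1 := by rw [hi]; push_cast; ring
    push_cast
    linear_combination h.sq_b / 4 + h.sq_c / 4 + h.sb_mul_sc / 2 + (b' / 4 : L) * ha +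
      (b' / 2 : L) * hg
  constructor
  · intro hx
    obtain ⟨⟨ha1, ha2⟩, ⟨hb1, hb2⟩, ⟨hc1, hc2⟩⟩ := h.isIntegral_pairs hx
    obtain ⟨m₀, m₁, h0', h1', e1⟩ := exists_two_mul_of_isIntegral_of_emod_eq_one h.squarefree_a
      h.emod_four (by push_cast; exact h.sq_a) ha1 ha2
    obtain ⟨n₀, n₂, h0, h2⟩ := exists_of_isIntegral_of_emod_ne_one h.squarefree_b
      hb (by push_cast; exact h.sq_b) hb1 hb2
    obtain ⟨_, n₃, -, h3⟩ := exists_of_isIntegral_of_emod_ne_one h.squarefree_c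
      (by rwa [h.emod_four_c]) (by push_cast; exact h.sq_c) hc1 hc2
    have hm₀ : m₀ = 2 * n₀ := by
      have : (m₀ : ℚ) = 2 * n₀ := by linarith
      exact_mod_cast this
    -- Comparison with ℚ(√b) shows 4x₀ = m₀ even, hence m₁ is even too.
    obtain ⟨n₁, rfl⟩ : 2 ∣ m₁ := by omega
    push_cast at h1'
    obtain rfl : x₀ = n₀ / 2 := by linarith
    obtain rfl : x₁ = n₁ / 2 := by linarith
    obtain rfl : x₂ = n₂ / 2 := by linarith
    obtain rfl : x₃ = n₃ / 2 := by linarith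
    -- Removing n₁(1+√a)/2 and n₃(√b+√c)/2 leaves an integer of ℚ(√b), whose coordinates are
    -- integers since b ≢ 1 mod 4.
    have hsub := (hx.sub ((int n₁).mul ia)).sub ((int n₃).mul ibc)
    have hsub' : IsIntegral ℤ (biquadElem sa sb sc ((n₀ - n₁ : ℤ) / 2) 0 ((n₂ - n₃ : ℤ) / 2) 0) := by
      refine hsub.of_eq ?_
      simp only [biquadElem]
      push_cast
      ring
    have hsub2 := (h.isIntegral_conj hsub').2.1
    obtain ⟨X, Y, hX, hY⟩ := exists_of_isIntegral_of_emod_ne_one (x := (n₀ - n₁ : ℤ) / 2)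
      (y := (n₂ - n₃ : ℤ) / 2) h.squarefree_b hb (s := sb) (by push_cast; exact h.sq_b)
      (by refine hsub'.of_eq ?_; simp [biquadElem])
      (by refine hsub2.of_eq ?_; simp [biquadElem]; ring)
    have hX' : n₀ - n₁ = 2 * X := by
      have : ((n₀ - n₁ : ℤ) : ℚ) = 2 * X := by linarith
      exact_mod_cast this
    have hY' : n₂ - n₃ = 2 * Y := by
      have : ((n₂ - n₃ : ℤ) : ℚ) = 2 * Y := by linarith
      exact_mod_cast this
    exact ⟨n₀, n₁, n₂, n₃, rfl, rfl, rfl, rfl, by omega, by omega⟩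
  · rintro ⟨n₀, n₁, n₂, n₃, rfl, rfl, rfl, rfl, ⟨k₁, hk₁⟩, ⟨k₂, hk₂⟩⟩
    obtain rfl : n₁ = n₀ + 2 * k₁ := by omega
    obtain rfl : n₃ = n₂ + 2 * k₂ := by omega
    refine (((((int (n₀ + 2 * k₁)).mul ia).add (int (-k₁))).add
      ((int (n₂ + 2 * k₂)).mul ibc)).sub ((int k₂).mul ib)).of_eq ?_
    simp only [biquadElem]
    push_cast
    ring

end IsBiquadratic

/-! ### The cyclic subgroup N of permutations of a Klein four-group -/

section KleinFour

variable {G : Type*} [Group G] {σ τ : G}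

/-- `G = {1, σ, τ, στ}` is a Klein four-group. -/
structure IsKleinFourPair (σ τ : G) : Prop where
  sq_left : σ * σ = 1
  sq_right : τ * τ = 1
  comm : τ * σ = σ * τ
  left_ne_one : σ ≠ 1
  right_ne_one : τ ≠ 1
  ne : σ ≠ τ
  eq_or : ∀ g : G, g = 1 ∨ g = σ ∨ g = τ ∨ g = σ * τ

namespace IsKleinFourPair

lemma left_mul_ne_one (h : IsKleinFourPair σ τ) : σ * τ ≠ 1 := fun e =>
  h.ne (mul_right_cancel (e.trans h.sq_right.symm))

lemma inv_left (h : IsKleinFourPair σ τ) : σ⁻¹ = σ := inv_eq_of_mul_eq_one_left h.sq_left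

lemma inv_right (h : IsKleinFourPair σ τ) : τ⁻¹ = τ := inv_eq_of_mul_eq_one_left h.sq_right

lemma perm_ext (h : IsKleinFourPair σ τ) {π ρ : Equiv.Perm G} (h1 : π 1 = ρ 1) (h2 : π σ = ρ σ)
    (h3 : π τ = ρ τ) (h4 : π (σ * τ) = ρ (σ * τ)) : π = ρ := by
  ext g
  rcases h.eq_or g with rfl | rfl | rfl | rfl <;> assumption

lemma exists_perm (h : IsKleinFourPair σ τ) :
    ∃ η : Equiv.Perm G, η 1 = σ * τ ∧ η σ = 1 ∧ η τ = σ ∧ η (σ * τ) = τ := by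
  classical
  have h1 := h.left_mul_ne_one
  have h2 := h.left_ne_one
  have h3 := h.right_ne_one
  have h4 := h.ne
  -- The 4-cycle 1 → στ → τ → σ → 1 as a product of transpositions.
  refine ⟨Equiv.swap 1 σ * Equiv.swap 1 τ * Equiv.swap 1 (σ * τ), ?_, ?_, ?_, ?_⟩
  · simp [Equiv.swap_apply_of_ne_of_ne, h1, h2, h3]
  · simp [Equiv.swap_apply_of_ne_of_ne, h2, h3, h4]
  · simp [Equiv.swap_apply_of_ne_of_ne, h2, h3]
  · simp [Equiv.swap_apply_of_ne_of_ne, h3, h4.symm]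

/-- The defining formulas at k, l ∈ {0, 1} force μ = η² and determine η completely, and η has fourth
power 1. Only this upper bound on N is needed, to bound supports. -/
lemma mem_cyclicRegularSubgroup (h : IsKleinFourPair σ τ) {η : Equiv.Perm G}
    (h1 : η 1 = σ * τ) (h2 : η σ = 1) (h3 : η τ = σ) (h4 : η (σ * τ) = τ) {π : Equiv.Perm G}
    (hπ : π ∈ cyclicRegularSubgroup σ τ) : π = 1 ∨ π = η ∨ π = η * η ∨ π = η⁻¹ := by
  have hle : cyclicRegularSubgroup σ τ ≤ Subgroup.zpowers η := by
    refine (Subgroup.closure_le _).2 (Set.union_subset ?_ ?_)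
    · intro μ hμ
      have e1 := hμ 0 0
      have e2 := hμ 1 0
      have e3 := hμ 0 1
      have e4 := hμ 1 1
      simp [h.inv_right] at e1 e2 e3 e4
      have : μ = η * η := h.perm_ext (by simp [e1, h1, h4]) (by simp [e2, h1, h2])
        (by simp [e3, h2, h3]) (by simp [e4, h3, h4])
      rw [this, ← sq]
      exact Subgroup.npow_mem_zpowers η 2
    · intro ρ hρ
      have e1 := hρ 0 0
      have e2 := hρ 1 0
      have e3 := hρ 0 1
      have e4 := hρ 1 1
      simp [h.inv_right, h.inv_left] at e1 e2 e3 e4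
      have : ρ = η := h.perm_ext (by simp [e1, h1]) (by simp [e2, h2])
        (by simp [e3, h3]) (by simp [e4, h4])
      rw [this]
      exact Subgroup.mem_zpowers η
  have h5 : η ^ (4 : ℤ) = 1 := by
    refine h.perm_ext ?_ ?_ ?_ ?_ <;>
      simp [zpow_ofNat, pow_succ, h1, h2, h3, h4]
  obtain ⟨n, rfl⟩ := Subgroup.mem_zpowers_iff.1 (hle hπ)
  obtain ⟨m, r, rfl, hr⟩ : ∃ m r : ℤ, n = 4 * m + r ∧ (r = 0 ∨ r = 1 ∨ r = 2 ∨ r = -1) := by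
    rcases (by omega : n % 4 = 0 ∨ n % 4 = 1 ∨ n % 4 = 2 ∨ n % 4 = 3) with e | e | e | e
    · exact ⟨n / 4, 0, by omega, by simp⟩
    · exact ⟨n / 4, 1, by omega, by simp⟩
    · exact ⟨n / 4, 2, by omega, by simp⟩
    · exact ⟨n / 4 + 1, -1, by omega, by simp⟩
  rw [zpow_add, zpow_mul, h5, one_zpow, one_mul]
  rcases hr with rfl | rfl | rfl | rfl <;> simp [zpow_ofNat, sq]

lemma conj_mulLeft_right (h : IsKleinFourPair σ τ) {η : Equiv.Perm G}
    (h1 : η 1 = σ * τ) (h2 : η σ = 1) (h3 : η τ = σ) (h4 : η (σ * τ) = τ) :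
    MulAut.conj (Equiv.mulLeft τ : Equiv.Perm G) η = η := by
  rw [MulAut.conj_apply, mul_inv_eq_iff_eq_mul]
  have e : τ * (σ * τ) = σ := by rw [← mul_assoc, h.comm, mul_assoc, h.sq_right, mul_one]
  refine h.perm_ext ?_ ?_ ?_ ?_ <;> simp [h1, h2, h3, h4, h.comm, h.sq_right, e]

lemma conj_mulLeft_left (h : IsKleinFourPair σ τ) {η : Equiv.Perm G}
    (h1 : η 1 = σ * τ) (h2 : η σ = 1) (h3 : η τ = σ) (h4 : η (σ * τ) = τ) :
    MulAut.conj (Equiv.mulLeft σ : Equiv.Perm G) η = η⁻¹ := by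
  rw [MulAut.conj_apply, mul_inv_eq_iff_eq_mul, eq_inv_mul_iff_mul_eq]
  have e : σ * (σ * τ) = τ := by rw [← mul_assoc, h.sq_left, one_mul]
  refine h.perm_ext ?_ ?_ ?_ ?_ <;> simp [h1, h2, h3, h4, h.sq_left, e]

end IsKleinFourPair

end KleinFour

/-! ### Elements of L[N]^G and their action on L -/

lemma coeff_galoisActPerm_conj {K L : Type*} [Field K] [Field L] [Algebra K L] (g : L ≃ₐ[K] L)
    (x : MonoidAlgebra L (Equiv.Perm (L ≃ₐ[K] L))) (π : Equiv.Perm (L ≃ₐ[K] L)) :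
    (galoisActPerm K L g x).coeff (MulAut.conj (Equiv.mulLeft g) π) = g (x.coeff π) := by
  change (Finsupp.mapDomain (MulAut.conj (Equiv.mulLeft g : Equiv.Perm (L ≃ₐ[K] L)))
    (MonoidAlgebra.map _ x).coeff) _ = _
  rw [Finsupp.mapDomain_apply (MulAut.conj _).injective, MonoidAlgebra.coeff_map]
  rfl

lemma mem_of_mem_range_mapDomain {K L : Type*} [Field K] [Field L] [Algebra K L]
    {N : Subgroup (Equiv.Perm (L ≃ₐ[K] L))} {x : MonoidAlgebra L (Equiv.Perm (L ≃ₐ[K] L))}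
    (hx : x ∈ (MonoidAlgebra.mapDomainAlgHom K L N.subtype).range)
    {π : Equiv.Perm (L ≃ₐ[K] L)} (hπ : x.coeff π ≠ 0) : π ∈ N := by
  obtain ⟨y, rfl⟩ := hx
  by_contra hN
  apply hπ
  change Finsupp.mapDomain N.subtype y.coeff π = 0
  exact Finsupp.mapDomain_of_notMem_range _ _ (by simpa using hN)

/-- The action of an element of the Greither-Pareigis algebra of a biquadratic extension for the
cyclic regular subgroup `N_{T,1}`. -/
lemma exists_greitherPareigisAct_eq {K L : Type*} [Field K] [Field L] [Algebra K L]
    {σ τ : L ≃ₐ[K] L} (h : IsKleinFourPair σ τ)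
    (x : greitherPareigisAlgebra K L (cyclicRegularSubgroup σ τ)) :
    ∃ c d e : L, σ c = c ∧ τ c = c ∧ σ d = d ∧ τ d = d ∧ τ e = e ∧
      ∀ v, greitherPareigisAct x.1 v = c * v + e * σ v + d * τ v + σ e * σ (τ v) := by
  classical
  obtain ⟨η, h1, h2, h3, h4⟩ := h.exists_perm
  obtain ⟨x, hx1, hx2⟩ := x
  have hfix (g : L ≃ₐ[K] L) (π) : x.coeff (MulAut.conj (Equiv.mulLeft g) π) = g (x.coeff π) := by
    have : galoisActPerm K L g x = x := (Algebra.mem_iInf.1 hx2) g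
    conv_lhs => rw [← this]
    exact coeff_galoisActPerm_conj g x π
  have cσ := h.conj_mulLeft_left h1 h2 h3 h4
  have cτ := h.conj_mulLeft_right h1 h2 h3 h4
  have hinv : η⁻¹ * η⁻¹ = η * η := by
    rw [← mul_inv_rev, inv_eq_iff_mul_eq_one]
    refine h.perm_ext ?_ ?_ ?_ ?_ <;> simp [h1, h2, h3, h4]
  -- Conjugation by τ fixes N pointwise and conjugation by σ inverts it. So the coefficients at 1
  -- and η² are fixed by σ and τ, that at η is fixed by τ, and that at η⁻¹ is its σ-conjugate.
  refine ⟨x.coeff 1, x.coeff (η * η), x.coeff η, ?_, ?_, ?_, ?_, ?_, fun v => ?_⟩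
  · rw [← hfix, map_one]
  · rw [← hfix, map_one]
  · rw [← hfix, map_mul, cσ, hinv]
  · rw [← hfix, map_mul, cτ]
  · rw [← hfix, cτ]
  have d1 : η ≠ 1 := fun e => h.left_mul_ne_one (by rw [← h1, e]; rfl)
  have d2 : η * η ≠ 1 := fun e => h.right_ne_one (by
    have := DFunLike.congr_fun e 1; simpa [h1, h4] using this)
  have d3 : η⁻¹ ≠ 1 := by simpa using d1
  have d4 : η * η ≠ η := by simpa using d1
  have d5 : η ≠ η⁻¹ := fun e => d2 (by nth_rw 2 [e]; simp)
  have d6 : η * η ≠ η⁻¹ := fun e => h.ne (by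
    have := DFunLike.congr_fun e 1
    rw [Equiv.Perm.eq_inv_iff_eq] at this
    simp [h1, h4, h3] at this
    exact absurd this h.left_ne_one)
  have hs : x.coeff.support ⊆ {1, η, η * η, η⁻¹} := fun π hπ => by
    simpa using h.mem_cyclicRegularSubgroup h1 h2 h3 h4
      (mem_of_mem_range_mapDomain hx1 (Finsupp.mem_support_iff.1 hπ))
  have i1 : η⁻¹ 1 = σ := by rw [Equiv.Perm.inv_eq_iff_eq, h2]
  have i2 : (η * η)⁻¹ 1 = τ := by rw [Equiv.Perm.inv_eq_iff_eq, Equiv.Perm.mul_apply, h3, h2]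
  rw [greitherPareigisAct, Finsupp.sum_of_support_subset _ hs _ (by simp),
    Finset.sum_insert (by simp [d1.symm, d2.symm, d3.symm]),
    Finset.sum_insert (by simp [d4.symm, d5]), Finset.sum_insert (by simp [d6]),
    Finset.sum_singleton, i1, i2, inv_inv, h1, ← cσ, hfix]
  simp only [inv_one, Equiv.Perm.one_apply, AlgEquiv.one_apply, AlgEquiv.mul_apply]
  ring

/-! ### Coordinates in the basis 1, √a, √b, √c -/

namespace IsBiquadratic

section Coordinates

variable {L : Type*} [Field L] [CharZero L] {g a' b' : ℤ} {sa sb sc : L}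

lemma eq_zero_of_biquadElem_eq_zero (h : IsBiquadratic L g a' b' sa sb sc) {x₀ x₁ x₂ x₃ : ℚ}
    (hx : biquadElem sa sb sc x₀ x₁ x₂ x₃ = 0) : x₀ = 0 ∧ x₁ = 0 ∧ x₂ = 0 ∧ x₃ = 0 := by
  have ha : (g * a' : L) ≠ 0 := by exact_mod_cast h.squarefree_a.ne_zero
  have hb : (g * b' : L) ≠ 0 := by exact_mod_cast h.squarefree_b.ne_zero
  have hsa : sa ≠ 0 := fun e => ha (by rw [← h.sq_a, e]; ring)
  have hsb : sb ≠ 0 := fun e => hb (by rw [← h.sq_b, e]; ring)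
  have hsc : sc ≠ 0 := fun e => mul_ne_zero hsa hsb (by rw [h.mul_eq, e]; ring)
  obtain ⟨σ, τ, h1, h2, h3, h4⟩ := h.exists_aut
  have h5 : σ sc = -sc := by
    apply mul_left_cancel₀ h.g_cast_ne_zero
    have := congrArg σ h.mul_eq
    simp only [map_mul, map_intCast, h1, h2] at this
    linear_combination -this - h.mul_eq
  have h6 : τ sc = -sc := by
    apply mul_left_cancel₀ h.g_cast_ne_zero
    have := congrArg τ h.mul_eq
    simp only [map_mul, map_intCast, h3, h4] at this
    linear_combination -this - h.mul_eq
  have e1 := congrArg σ hx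
  have e2 := congrArg τ hx
  have e3 := congrArg (fun v => σ (τ v)) hx
  simp only [biquadElem, map_add, map_mul, map_ratCast, map_zero, map_neg, h1, h2, h3, h4, h5, h6]
    at hx e1 e2 e3
  have f0 : (4 * x₀ : L) = 0 := by linear_combination hx + e1 + e2 + e3
  have f1 : (4 * x₁ : L) * sa = 0 := by linear_combination hx - e1 + e2 - e3
  have f2 : (4 * x₂ : L) * sb = 0 := by linear_combination hx + e1 - e2 - e3
  have f3 : (4 * x₃ : L) * sc = 0 := by linear_combination hx - e1 - e2 + e3
  exact ⟨by simpa using f0, by simpa [hsa] using f1, by simpa [hsb] using f2,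
    by simpa [hsc] using f3⟩

lemma biquadElem_inj (h : IsBiquadratic L g a' b' sa sb sc) {x₀ x₁ x₂ x₃ y₀ y₁ y₂ y₃ : ℚ} :
    biquadElem sa sb sc x₀ x₁ x₂ x₃ = biquadElem sa sb sc y₀ y₁ y₂ y₃ ↔
      x₀ = y₀ ∧ x₁ = y₁ ∧ x₂ = y₂ ∧ x₃ = y₃ := by
  constructor
  · intro e
    have := h.eq_zero_of_biquadElem_eq_zero
      (x₀ := x₀ - y₀) (x₁ := x₁ - y₁) (x₂ := x₂ - y₂) (x₃ := x₃ - y₃) (by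
        simp only [biquadElem] at e ⊢
        push_cast
        linear_combination e)
    simpa only [sub_eq_zero] using this
  · rintro ⟨rfl, rfl, rfl, rfl⟩
    rfl

end Coordinates

variable {L : Type*} [Field L] [NumberField L] {g a' b' : ℤ} {sa sb sc : L}

lemma exists_eq_biquadElem (h : IsBiquadratic L g a' b' sa sb sc)
    (hdeg : Module.finrank ℚ L = 4) (v : L) :
    ∃ x₀ x₁ x₂ x₃ : ℚ, v = biquadElem sa sb sc x₀ x₁ x₂ x₃ := by
  have hli : LinearIndependent ℚ ![1, sa, sb, sc] := by
    rw [Fintype.linearIndependent_iff]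
    intro f hf
    simp only [Fin.sum_univ_four, Rat.smul_def, Matrix.cons_val] at hf
    obtain ⟨h0, h1, h2, h3⟩ := h.eq_zero_of_biquadElem_eq_zero
      (x₀ := f 0) (x₁ := f 1) (x₂ := f 2) (x₃ := f 3) (by
        rw [← hf, biquadElem, mul_one])
    intro i
    fin_cases i <;> assumption
  have hspan := hli.span_eq_top_of_card_eq_finrank' (by simp [hdeg])
  have hv : v ∈ Submodule.span ℚ (Set.range ![1, sa, sb, sc]) := hspan ▸ Submodule.mem_top
  obtain ⟨f, hf⟩ := (Submodule.mem_span_range_iff_exists_fun ℚ).1 hv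
  refine ⟨f 0, f 1, f 2, f 3, ?_⟩
  rw [← hf]
  simp [Fin.sum_univ_four, Rat.smul_def, biquadElem]

end IsBiquadratic

/-! ### H as the algebra ℚ × ℚ × ℚ(√-a) -/

/-- `h` acts on `L = ℚ(√a, √b)` through the element `r` of `ℚ × ℚ × ℚ(√-a)`. -/
def ActsAs {L H : Type*} [Field L] [Ring H] [Module H L] (g a' : ℤ) (sa sb sc : L) {D : ℚ}
    (h : H) (r : ℚ × ℚ × QuadraticAlgebra ℚ D 0) : Prop :=
  ∀ x₀ x₁ x₂ x₃ : ℚ, h • biquadElem sa sb sc x₀ x₁ x₂ x₃ =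
    biquadElem sa sb sc (r.1 * x₀) (r.2.1 * x₁) (r.2.2.re * x₂ - a' * r.2.2.im * x₃)
      (r.2.2.re * x₃ + g * r.2.2.im * x₂)

section HopfAlgebra

variable {L : Type*} [Field L] {g a' b' : ℤ} {sa sb sc : L} {H : Type*} [Ring H] [Module H L] {D : ℚ}

lemma ActsAs.mul {h k : H} {r s : ℚ × ℚ × QuadraticAlgebra ℚ D 0} (hD : D = -(g * a'))
    (hr : ActsAs g a' sa sb sc h r) (hs : ActsAs g a' sa sb sc k s) :
    ActsAs g a' sa sb sc (h * k) (r * s) := fun x₀ x₁ x₂ x₃ => by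
  subst hD
  rw [mul_smul, hs, hr]
  congr 1 <;> simp <;> ring

variable [CharZero L]

lemma ActsAs.unique (hB : IsBiquadratic L g a' b' sa sb sc) {h : H}
    {r s : ℚ × ℚ × QuadraticAlgebra ℚ D 0} (hr : ActsAs g a' sa sb sc h r)
    (hs : ActsAs g a' sa sb sc h s) : r = s := by
  -- This vector recovers every component of r, the last one multiplied by g ≠ 0.
  have e := (hr 1 1 1 0).symm.trans (hs 1 1 1 0)
  rw [hB.biquadElem_inj] at e
  have hg : (g : ℚ) ≠ 0 := by exact_mod_cast hB.g_ne_zero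
  obtain ⟨e0, e1, e2, e3⟩ := e
  ext
  · simpa using e0
  · simpa using e1
  · simpa using e2
  · simpa [hg] using e3

lemma ActsAs.add {h k : H} {r s : ℚ × ℚ × QuadraticAlgebra ℚ D 0}
    (hr : ActsAs g a' sa sb sc h r) (hs : ActsAs g a' sa sb sc k s) :
    ActsAs g a' sa sb sc (h + k) (r + s) := fun x₀ x₁ x₂ x₃ => by
  rw [add_smul, hs, hr]
  simp only [biquadElem, Prod.fst_add, Prod.snd_add, QuadraticAlgebra.re_add,
    QuadraticAlgebra.im_add]
  push_cast
  ring

variable [Algebra ℚ H] [IsScalarTower ℚ H L]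

lemma actsAs_algebraMap (q : ℚ) :
    ActsAs g a' sa sb sc (algebraMap ℚ H q)
      (algebraMap ℚ (ℚ × ℚ × QuadraticAlgebra ℚ D 0) q) := fun x₀ x₁ x₂ x₃ => by
  rw [algebraMap_smul, Rat.smul_def]
  simp only [biquadElem, Prod.algebraMap_apply, QuadraticAlgebra.algebraMap_re,
    QuadraticAlgebra.algebraMap_im, Algebra.algebraMap_self, RingHom.id_apply]
  push_cast
  ring

/-- The action determines the element through which it acts, so any choice of elements is
automatically compatible with the algebra operations. -/
lemma exists_algHom_actsAs (hB : IsBiquadratic L g a' b' sa sb sc) (hD : D = -(g * a'))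
    (hex : ∀ h : H, ∃ r : ℚ × ℚ × QuadraticAlgebra ℚ D 0, ActsAs g a' sa sb sc h r) :
    ∃ Φ : H →ₐ[ℚ] ℚ × ℚ × QuadraticAlgebra ℚ D 0, ∀ h, ActsAs g a' sa sb sc h (Φ h) := by
  choose f hf using hex
  have hc (q : ℚ) : f (algebraMap ℚ H q) = algebraMap ℚ _ q :=
    (hf _).unique hB (actsAs_algebraMap q)
  exact ⟨{ toFun := f
           map_one' := by rw [← map_one (algebraMap ℚ H), hc, map_one]
           map_zero' := by rw [← map_zero (algebraMap ℚ H), hc, map_zero]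
           map_mul' := fun h k => (hf _).unique hB ((hf h).mul hD (hf k))
           map_add' := fun h k => (hf _).unique hB ((hf h).add (hf k))
           commutes' := hc }, hf⟩

end HopfAlgebra

lemma exists_actsAs {L : Type*} [Field L]
    [NumberField L] {g a' b' : ℤ} {sa sb sc : L} {H : Type*} [Ring H] [Module H L] {D : ℚ}
    [Algebra ℚ H] (hB : IsBiquadratic L g a' b' sa sb sc)
    (hdeg : Module.finrank ℚ L = 4) {σ τ : L ≃ₐ[ℚ] L} (hG : IsKleinFourPair σ τ)
    (h1 : σ sa = -sa) (h2 : σ sb = sb ∨ σ sb = -sb) (h3 : τ sa = sa) (h4 : τ sb = -sb)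
    (φ : H ≃ₐ[ℚ] greitherPareigisAlgebra ℚ L (cyclicRegularSubgroup σ τ))
    (hφ : ∀ (h : H) (v : L), h • v = greitherPareigisAct (φ h).1 v) (h : H) :
    ∃ r : ℚ × ℚ × QuadraticAlgebra ℚ D 0, ActsAs g a' sa sb sc h r := by
  -- σ is only determined up to τ, so its sign on √b is kept as a parameter; it ends up in the
  -- coefficient of ω.
  obtain ⟨ε, hε, h2⟩ : ∃ ε : ℚ, (ε = 1 ∨ ε = -1) ∧ σ sb = ε * sb := by
    rcases h2 with h2 | h2
    · exact ⟨1, by simp, by simp [h2]⟩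
    · exact ⟨-1, by simp, by simp [h2]⟩
  have h5 : σ sc = -(ε * sc) := by
    apply mul_left_cancel₀ hB.g_cast_ne_zero
    have := congrArg σ hB.mul_eq
    simp only [map_mul, map_intCast, h1, h2] at this
    linear_combination -this - ε * hB.mul_eq
  have h6 : τ sc = -sc := by
    apply mul_left_cancel₀ hB.g_cast_ne_zero
    have := congrArg τ hB.mul_eq
    simp only [map_mul, map_intCast, h3, h4] at this
    linear_combination -this - hB.mul_eq
  have hσ (x₀ x₁ x₂ x₃ : ℚ) : σ (biquadElem sa sb sc x₀ x₁ x₂ x₃) =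
      biquadElem sa sb sc x₀ (-x₁) (ε * x₂) (-(ε * x₃)) := by
    simp only [biquadElem, map_add, map_mul, map_ratCast, h1, h2, h5]
    push_cast; ring
  have hτ (x₀ x₁ x₂ x₃ : ℚ) : τ (biquadElem sa sb sc x₀ x₁ x₂ x₃) =
      biquadElem sa sb sc x₀ x₁ (-x₂) (-x₃) := by
    simp only [biquadElem, map_add, map_mul, map_ratCast, h3, h4, h6]
    push_cast; ring
  have hrat {c : L} (c1 : σ c = c) (c2 : τ c = c) : ∃ q : ℚ, c = q := by
    obtain ⟨x₀, x₁, x₂, x₃, rfl⟩ := hB.exists_eq_biquadElem hdeg c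
    rw [hσ, hB.biquadElem_inj] at c1
    rw [hτ, hB.biquadElem_inj] at c2
    obtain rfl : x₁ = 0 := by linarith [c1.2.1]
    obtain rfl : x₂ = 0 := by linarith [c2.2.2.1]
    obtain rfl : x₃ = 0 := by linarith [c2.2.2.2]
    exact ⟨x₀, by simp [biquadElem]⟩
  obtain ⟨c, d, e, c1, c2, d1, d2, e2, hact⟩ := exists_greitherPareigisAct_eq hG (φ h)
  obtain ⟨c, rfl⟩ := hrat c1 c2
  obtain ⟨d, rfl⟩ := hrat d1 d2
  obtain ⟨r, s, he⟩ : ∃ r s : ℚ, e = r + s * sa := by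
    obtain ⟨x₀, x₁, x₂, x₃, rfl⟩ := hB.exists_eq_biquadElem hdeg e
    rw [hτ, hB.biquadElem_inj] at e2
    obtain rfl : x₂ = 0 := by linarith [e2.2.2.1]
    obtain rfl : x₃ = 0 := by linarith [e2.2.2.2]
    exact ⟨x₀, x₁, by simp [biquadElem]⟩
  have he' : σ e = r - s * sa := by
    rw [he]
    simp only [map_add, map_mul, map_ratCast, h1]
    ring
  refine ⟨(c + d + 2 * r, c + d - 2 * r, ⟨c - d, 2 * s * ε⟩), fun x₀ x₁ x₂ x₃ => ?_⟩
  rw [hφ, hact, he', he, hτ, hσ, hσ]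
  simp only [biquadElem]
  push_cast
  linear_combination (2 * s * ε * x₂ : L) * hB.mul_eq - (2 * s * ε * x₃ : L) * hB.sa_mul_sc

section HopfGalois

variable {K L H : Type*} [Field K] [Field L] [Algebra K L] [Ring H] [HopfAlgebra K H]
  [Module H L] [IsScalarTower K H L]

lemma IsHopfGaloisStructure.eq_zero_of_smul_eq_zero (hH : IsHopfGaloisStructure K L H) {h : H}
    (h0 : ∀ v : L, h • v = 0) : h = 0 := by
  have h1 : hopfGaloisMap K L H (1 ⊗ₜ h) = 0 := by
    ext v
    simp [hopfGaloisMap, h0]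
  have h2 : (1 : L) ⊗ₜ[K] h = 0 := hH.bijective.1 (by rw [h1, map_zero])
  exact Algebra.TensorProduct.includeRight_injective (R := K) (A := L) (B := H)
    (algebraMap K L).injective (by simpa using h2)

lemma IsHopfGaloisStructure.finrank_eq [FiniteDimensional K L]
    (hH : IsHopfGaloisStructure K L H) : Module.finrank K H = Module.finrank K L := by
  have h := (LinearEquiv.ofBijective _ hH.bijective).finrank_eq
  rw [Module.finrank_tensorProduct,
    show Module.finrank K (Module.End K L) = _ from Module.finrank_linearMap K K L L] at h
  exact Nat.eq_of_mul_eq_mul_left Module.finrank_pos h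

end HopfGalois

/-- H acts faithfully by injectivity of the canonical map, so the homomorphism is injective; both
sides have dimension 4. -/
lemma exists_algEquiv_actsAs {L : Type*} [Field L] [NumberField L] {g a' b' : ℤ} {sa sb sc : L}
    (hB : IsBiquadratic L g a' b' sa sb sc) (hdeg : Module.finrank ℚ L = 4) {D : ℚ}
    (hD : D = -(g * a')) {H : Type*} [Ring H] [HopfAlgebra ℚ H] [Module H L] [IsScalarTower ℚ H L]
    (hH : IsHopfGaloisStructure ℚ L H)
    (hex : ∀ h : H, ∃ r : ℚ × ℚ × QuadraticAlgebra ℚ D 0, ActsAs g a' sa sb sc h r) :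
    ∃ Φ : H ≃ₐ[ℚ] ℚ × ℚ × QuadraticAlgebra ℚ D 0, ∀ h, ActsAs g a' sa sb sc h (Φ h) := by
  obtain ⟨Φ, hΦ⟩ := exists_algHom_actsAs hB hD hex
  have hinj : Function.Injective Φ := by
    rw [injective_iff_map_eq_zero]
    intro h hh
    refine hH.eq_zero_of_smul_eq_zero fun v => ?_
    obtain ⟨x₀, x₁, x₂, x₃, rfl⟩ := hB.exists_eq_biquadElem hdeg v
    rw [hΦ, hh]
    simp [biquadElem]
  have := hH.finiteDimensional
  have hfin : Module.finrank ℚ H = Module.finrank ℚ (ℚ × ℚ × QuadraticAlgebra ℚ D 0) := by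
    rw [hH.finrank_eq, hdeg, Module.finrank_prod, Module.finrank_prod,
      QuadraticAlgebra.finrank_eq_two, Module.finrank_self]
  have hsurj : Function.Surjective Φ :=
    (LinearMap.injective_iff_surjective_of_finrank_eq_finrank (f := Φ.toLinearMap) hfin).1 hinj
  exact ⟨AlgEquiv.ofBijective Φ ⟨hinj, hsurj⟩, hΦ⟩

/-! ### Freeness over the associated order and lattice generators -/

section Freeness

variable {L : Type*} [Field L] [NumberField L] {g a' b' : ℤ} {sa sb sc : L}
  {H : Type*} [Ring H] [Module H L] {D : ℚ} {I : ℚ → ℚ → ℚ → ℚ → Prop}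

lemma mem_associatedOrder_iff_preserves (hB : IsBiquadratic L g a' b' sa sb sc)
    (hdeg : Module.finrank ℚ L = 4)
    (hI : ∀ x₀ x₁ x₂ x₃, IsIntegral ℤ (biquadElem sa sb sc x₀ x₁ x₂ x₃) ↔ I x₀ x₁ x₂ x₃)
    {h : H} {r : ℚ × ℚ × QuadraticAlgebra ℚ D 0} (hr : ActsAs g a' sa sb sc h r) :
    h ∈ associatedOrder L H ↔ Preserves I g a' r.1 r.2.1 r.2.2.re r.2.2.im := by
  change (∀ x : L, IsIntegral ℤ x → IsIntegral ℤ (h • x)) ↔ _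
  constructor
  · intro hh x₀ x₁ x₂ x₃ hx
    rw [← hI, ← hr]
    exact hh _ ((hI _ _ _ _).2 hx)
  · intro hp x hx
    obtain ⟨x₀, x₁, x₂, x₃, rfl⟩ := hB.exists_eq_biquadElem hdeg x
    rw [hr, hI]
    exact hp _ _ _ _ ((hI _ _ _ _).1 hx)

/-- A generator of the lattice of integers gives a basis of the ring of integers over the
associated order. -/
lemma free_of_generates (hB : IsBiquadratic L g a' b' sa sb sc)
    (hdeg : Module.finrank ℚ L = 4)
    (hI : ∀ x₀ x₁ x₂ x₃, IsIntegral ℤ (biquadElem sa sb sc x₀ x₁ x₂ x₃) ↔ I x₀ x₁ x₂ x₃)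
    (Φ : H ≃+* ℚ × ℚ × QuadraticAlgebra ℚ D 0) (hΦ : ∀ h, ActsAs g a' sa sb sc h (Φ h))
    {x₀ x₁ x₂ x₃ : ℚ} (hx : I x₀ x₁ x₂ x₃) (h0 : x₀ ≠ 0) (h1 : x₁ ≠ 0)
    (hN : g * x₂ ^ 2 + a' * x₃ ^ 2 ≠ 0) (hgen : Generates I g a' x₀ x₁ x₂ x₃) :
    Module.Free (associatedOrder L H) (NumberField.RingOfIntegers L) := by
  let α : NumberField.RingOfIntegers L := ⟨biquadElem sa sb sc x₀ x₁ x₂ x₃, (hI _ _ _ _).2 hx⟩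
  have hbij : Function.Bijective (LinearMap.toSpanSingleton (associatedOrder L H) _ α) := by
    constructor
    · rw [injective_iff_map_eq_zero]
      rintro ⟨h, hh⟩ e
      have e' : h • biquadElem sa sb sc x₀ x₁ x₂ x₃ = 0 := congrArg Subtype.val e
      rw [hΦ] at e'
      obtain ⟨e0, e1, e2, e3⟩ := hB.eq_zero_of_biquadElem_eq_zero e'
      -- Cramer's rule again: the norm form is the determinant of the action on the plane of √b, √c.
      have e4 : (Φ h).2.2.re * (g * x₂ ^ 2 + a' * x₃ ^ 2) = 0 := by
        linear_combination g * x₂ * e2 + a' * x₃ * e3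
      have e5 : (Φ h).2.2.im * (g * x₂ ^ 2 + a' * x₃ ^ 2) = 0 := by
        linear_combination x₂ * e3 - x₃ * e2
      have hz : Φ h = 0 := by
        ext
        · simpa [h0] using e0
        · simpa [h1] using e1
        · exact (mul_eq_zero.1 e4).resolve_right hN
        · exact (mul_eq_zero.1 e5).resolve_right hN
      exact Subtype.ext ((map_eq_zero_iff Φ Φ.injective).1 hz)
    · rintro ⟨v, hv⟩
      obtain ⟨y₀, y₁, y₂, y₃, rfl⟩ := hB.exists_eq_biquadElem hdeg v
      obtain ⟨p₀, p₁, p, q, hp, e0, e1, e2, e3⟩ := hgen _ _ _ _ ((hI _ _ _ _).1 hv)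
      obtain ⟨h, hh⟩ := Φ.surjective (p₀, p₁, ⟨p, q⟩)
      have hact := hΦ h
      rw [hh] at hact
      refine ⟨⟨h, (mem_associatedOrder_iff_preserves hB hdeg hI hact).2 hp⟩, Subtype.ext ?_⟩
      change h • biquadElem sa sb sc x₀ x₁ x₂ x₃ = _
      rw [hact]
      exact hB.biquadElem_inj.2 ⟨e0, e1, e2, e3⟩
  exact Module.Free.of_equiv (LinearEquiv.ofBijective _ hbij)

lemma Rat.exists_int_mul_eq (q : ℚ) : ∃ n : ℤ, n ≠ 0 ∧ ∃ m : ℤ, n * q = m :=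
  ⟨q.den, by exact_mod_cast q.den_nz, q.num, by exact_mod_cast Rat.den_mul_eq_num q⟩

/-- The lattice lies between ℤ⁴ and (1/4)ℤ⁴, so 4 times a common denominator of the components
suffices. -/
lemma exists_zsmul_mem_associatedOrder (hB : IsBiquadratic L g a' b' sa sb sc)
    (hdeg : Module.finrank ℚ L = 4)
    (hI : ∀ x₀ x₁ x₂ x₃, IsIntegral ℤ (biquadElem sa sb sc x₀ x₁ x₂ x₃) ↔ I x₀ x₁ x₂ x₃)
    (h4 : ∀ x₀ x₁ x₂ x₃, I x₀ x₁ x₂ x₃ →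
      ∃ n₀ n₁ n₂ n₃ : ℤ, 4 * x₀ = n₀ ∧ 4 * x₁ = n₁ ∧ 4 * x₂ = n₂ ∧ 4 * x₃ = n₃)
    (h1 : ∀ n₀ n₁ n₂ n₃ : ℤ, I n₀ n₁ n₂ n₃)
    (Φ : H ≃+* ℚ × ℚ × QuadraticAlgebra ℚ D 0) (hΦ : ∀ h, ActsAs g a' sa sb sc h (Φ h)) (h : H) :
    ∃ n : ℤ, n ≠ 0 ∧ n • h ∈ associatedOrder L H := by
  obtain ⟨d₀, hd₀, m₀, e₀⟩ := Rat.exists_int_mul_eq (Φ h).1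
  obtain ⟨d₁, hd₁, m₁, e₁⟩ := Rat.exists_int_mul_eq (Φ h).2.1
  obtain ⟨d₂, hd₂, m₂, e₂⟩ := Rat.exists_int_mul_eq (Φ h).2.2.re
  obtain ⟨d₃, hd₃, m₃, e₃⟩ := Rat.exists_int_mul_eq (Φ h).2.2.im
  refine ⟨4 * (d₀ * d₁ * d₂ * d₃), by positivity, ?_⟩
  rw [mem_associatedOrder_iff_preserves hB hdeg hI (hΦ _), map_zsmul]
  intro x₀ x₁ x₂ x₃ hx
  obtain ⟨n₀, n₁, n₂, n₃, f₀, f₁, f₂, f₃⟩ := h4 _ _ _ _ hx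
  convert h1 (d₁ * d₂ * d₃ * m₀ * n₀) (d₀ * d₂ * d₃ * m₁ * n₁)
    (d₀ * d₁ * d₃ * m₂ * n₂ - a' * (d₀ * d₁ * d₂ * m₃ * n₃))
    (d₀ * d₁ * d₃ * m₂ * n₃ + g * (d₀ * d₁ * d₂ * m₃ * n₂)) using 1 <;>
  · simp only [Prod.smul_fst, Prod.smul_snd, QuadraticAlgebra.re_smul,
      QuadraticAlgebra.im_smul]
    simp only [zsmul_eq_mul]
    push_cast
    simp only [← e₀, ← e₁, ← e₂, ← e₃, ← f₀, ← f₁, ← f₂, ← f₃]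
    ring

/-- If the ring of integers is free over the associated order then it has a basis consisting of
one element. -/
lemma exists_generates_of_free (hB : IsBiquadratic L g a' b' sa sb sc)
    (hdeg : Module.finrank ℚ L = 4)
    (hI : ∀ x₀ x₁ x₂ x₃, IsIntegral ℤ (biquadElem sa sb sc x₀ x₁ x₂ x₃) ↔ I x₀ x₁ x₂ x₃)
    (h4 : ∀ x₀ x₁ x₂ x₃, I x₀ x₁ x₂ x₃ →
      ∃ n₀ n₁ n₂ n₃ : ℤ, 4 * x₀ = n₀ ∧ 4 * x₁ = n₁ ∧ 4 * x₂ = n₂ ∧ 4 * x₃ = n₃)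
    (h1 : ∀ n₀ n₁ n₂ n₃ : ℤ, I n₀ n₁ n₂ n₃)
    (Φ : H ≃+* ℚ × ℚ × QuadraticAlgebra ℚ D 0) (hΦ : ∀ h, ActsAs g a' sa sb sc h (Φ h))
    [Module.Free (associatedOrder L H) (NumberField.RingOfIntegers L)] :
    ∃ x₀ x₁ x₂ x₃, I x₀ x₁ x₂ x₃ ∧ Generates I g a' x₀ x₁ x₂ x₃ := by
  have hnt : Nontrivial H := Φ.toEquiv.nontrivial
  let B := Module.Free.chooseBasis (associatedOrder L H) (NumberField.RingOfIntegers L)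
  have hg : (g : ℚ) ≠ 0 := by exact_mod_cast hB.g_ne_zero
  have hcomm (h k : H) : h * k = k * h := Φ.injective (by rw [map_mul, map_mul, mul_comm])
  -- L is a cyclic H-module, generated by 1 + √a + √b.
  have hcyc (v : L) : ∃ h : H, h • biquadElem sa sb sc 1 1 1 0 = v := by
    obtain ⟨x₀, x₁, x₂, x₃, rfl⟩ := hB.exists_eq_biquadElem hdeg v
    obtain ⟨h, hh⟩ := Φ.surjective (x₀, x₁, ⟨x₂, x₃ / g⟩)
    refine ⟨h, ?_⟩
    have := hΦ h
    rw [hh] at this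
    rw [this]
    congr 1 <;> simp
    field_simp
  have hsub : Subsingleton (Module.Free.ChooseBasisIndex (associatedOrder L H)
      (NumberField.RingOfIntegers L)) := by
    refine ⟨fun i j => by_contra fun hij => ?_⟩
    obtain ⟨V, hV⟩ := hcyc (B i : L)
    obtain ⟨W, hW⟩ := hcyc (B j : L)
    obtain ⟨m, hm, hmV⟩ := exists_zsmul_mem_associatedOrder hB hdeg hI h4 h1 Φ hΦ V
    obtain ⟨n, hn, hnW⟩ := exists_zsmul_mem_associatedOrder hB hdeg hI h4 h1 Φ hΦ W
    -- If two basis elements are Vw and Ww with w the cyclic generator, commutativity gives W(Vw) =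
    -- V(Ww). Cleared of denominators, this is a linear relation over the associated order, which
    -- forces W = 0.
    let s : associatedOrder L H := ⟨m • (n • W), zsmul_mem hnW m⟩
    let t : associatedOrder L H := ⟨n • (m • V), zsmul_mem hmV n⟩
    have hrel : s • B i = t • B j := by
      apply Subtype.ext
      change (m • (n • W)) • (B i : L) = (n • (m • V)) • (B j : L)
      have e : (m • n • W) * V = (n • m • V) * W := by
        rw [smul_mul_assoc, smul_mul_assoc, smul_mul_assoc, smul_mul_assoc, hcomm W V, smul_comm]
      rw [← hV, ← hW, ← mul_smul (m • n • W), ← mul_smul (n • m • V), e]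
    have hs : s = 0 := by
      have := congrArg (fun v => B.repr v i) hrel
      simpa [Finsupp.single_apply, Ne.symm hij] using this
    have hW0 : W = 0 := by
      have h0 : m • (n • W) = 0 := congrArg Subtype.val hs
      have h1 : (m * n) • Φ W = 0 := by rw [mul_smul, ← map_zsmul, ← map_zsmul, h0, map_zero]
      have h2 : Φ W = 0 := by
        have hmn : ((m * n : ℤ) : ℚ) ≠ 0 := by exact_mod_cast mul_ne_zero hm hn
        rw [← Int.cast_smul_eq_zsmul ℚ] at h1
        exact (smul_eq_zero.1 h1).resolve_left hmn
      exact (map_eq_zero_iff Φ Φ.injective).1 h2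
    refine B.ne_zero j (Subtype.ext ?_)
    change (B j : L) = 0
    rw [← hW, hW0, zero_smul]
  obtain ⟨i⟩ := B.index_nonempty
  obtain ⟨x₀, x₁, x₂, x₃, hx⟩ := hB.exists_eq_biquadElem hdeg (B i : L)
  refine ⟨x₀, x₁, x₂, x₃, ?_, fun y₀ y₁ y₂ y₃ hy => ?_⟩
  · rw [← hI, ← hx]
    exact (B i).2
  · let v : NumberField.RingOfIntegers L :=
      ⟨biquadElem sa sb sc y₀ y₁ y₂ y₃, (hI _ _ _ _).2 hy⟩
    have hv : B.repr v i • B i = v := by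
      have : Unique (Module.Free.ChooseBasisIndex (associatedOrder L H)
        (NumberField.RingOfIntegers L)) := ⟨⟨i⟩, fun _ => Subsingleton.elim _ _⟩
      conv_rhs => rw [← B.linearCombination_repr v]
      rw [Finsupp.linearCombination_unique, Subsingleton.elim default i]
    generalize B.repr v i = c at hv
    obtain ⟨h, hh⟩ := c
    have hv' : h • biquadElem sa sb sc x₀ x₁ x₂ x₃ = biquadElem sa sb sc y₀ y₁ y₂ y₃ := by
      rw [← hx]
      exact congrArg Subtype.val hv
    rw [hΦ, hB.biquadElem_inj] at hv'
    exact ⟨_, _, _, _, (mem_associatedOrder_iff_preserves hB hdeg hI (hΦ h)).1 hh, hv'⟩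

end Freeness

/-! ### The Galois group of L and the conclusion -/

section Biquadratic

variable {L : Type*} [Field L] [NumberField L] {sa sb : L}

lemma algEquiv_ext_of_adjoin_eq_top (hL : IntermediateField.adjoin ℚ {sa, sb} = ⊤)
    {f k : L ≃ₐ[ℚ] L} (h1 : f sa = k sa) (h2 : f sb = k sb) : f = k := by
  ext v
  have hv : v ∈ IntermediateField.adjoin ℚ {sa, sb} := hL ▸ IntermediateField.mem_top
  induction hv using IntermediateField.adjoin_induction with
  | mem x hx => rcases hx with rfl | rfl <;> assumption
  | algebraMap x => rw [f.commutes, k.commutes]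
  | add x y _ _ hx hy => rw [map_add, map_add, hx, hy]
  | inv x _ hx => rw [map_inv₀, map_inv₀, hx]
  | mul x y _ _ hx hy => rw [map_mul, map_mul, hx, hy]

lemma isKleinFourPair_of_biquadratic (hL : IntermediateField.adjoin ℚ {sa, sb} = ⊤)
    (hsb0 : sb ≠ 0) {a b : ℤ} (hsa : sa ^ 2 = (a : L)) (hsb : sb ^ 2 = (b : L))
    {σ τ : L ≃ₐ[ℚ] L} (hτ : τ ≠ 1) (hτa : τ sa = sa) (hσa : σ sa ≠ sa) :
    IsKleinFourPair σ τ ∧ σ sa = -sa ∧ (σ sb = sb ∨ σ sb = -sb) ∧ τ sb = -sb := by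
  have ha (f : L ≃ₐ[ℚ] L) : f sa = sa ∨ f sa = -sa := by
    rw [← sq_eq_sq_iff_eq_or_eq_neg, ← map_pow, hsa, map_intCast]
  have hb (f : L ≃ₐ[ℚ] L) : f sb = sb ∨ f sb = -sb := by
    rw [← sq_eq_sq_iff_eq_or_eq_neg, ← map_pow, hsb, map_intCast]
  have h1 : σ sa = -sa := (ha σ).resolve_left hσa
  have h4 : τ sb = -sb := (hb τ).resolve_left fun h => hτ
    (algEquiv_ext_of_adjoin_eq_top hL (by simpa using hτa) (by simpa using h))
  have hsbn : sb ≠ -sb := fun h => hsb0 (self_eq_neg.1 h)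
  refine ⟨⟨?_, ?_, ?_, ?_, hτ, ?_, fun f => ?_⟩, h1, hb σ, h4⟩
  · refine algEquiv_ext_of_adjoin_eq_top hL (by simp [h1]) ?_
    rcases hb σ with h | h <;> simp [h]
  · exact algEquiv_ext_of_adjoin_eq_top hL (by simp [hτa]) (by simp [h4])
  · refine algEquiv_ext_of_adjoin_eq_top hL (by simp [h1, hτa]) ?_
    rcases hb σ with h | h <;> simp [h, h4]
  · rintro rfl
    exact hσa rfl
  · rintro rfl
    exact hσa hτa
  · rcases ha f with e1 | e1 <;> rcases hb f with e2 | e2 <;> rcases hb σ with h | h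
    · exact .inl (algEquiv_ext_of_adjoin_eq_top hL (by simp [e1]) (by simp [e2]))
    · exact .inl (algEquiv_ext_of_adjoin_eq_top hL (by simp [e1]) (by simp [e2]))
    · exact .inr (.inr (.inl (algEquiv_ext_of_adjoin_eq_top hL (by simp [e1, hτa])
        (by simp [e2, h4]))))
    · exact .inr (.inr (.inl (algEquiv_ext_of_adjoin_eq_top hL (by simp [e1, hτa])
        (by simp [e2, h4]))))
    · exact .inr (.inl (algEquiv_ext_of_adjoin_eq_top hL (by simp [e1, h1]) (by simp [e2, h])))
    · exact .inr (.inr (.inr (algEquiv_ext_of_adjoin_eq_top hL (by simp [e1, h1, hτa])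
        (by simp [e2, h, h4]))))
    · exact .inr (.inr (.inr (algEquiv_ext_of_adjoin_eq_top hL (by simp [e1, h1, hτa])
        (by simp [e2, h, h4]))))
    · exact .inr (.inl (algEquiv_ext_of_adjoin_eq_top hL (by simp [e1, h1]) (by simp [e2, h])))

end Biquadratic

/-- Freeness of the ring of integers over the associated order in terms of a norm equation. -/
theorem free_associatedOrder_iff {L : Type*} [Field L] [NumberField L] {g a' b' : ℤ}
    {sa sb sc : L} {H : Type*} [Ring H] [Module H L] {D : ℚ}
    (hB : IsBiquadratic L g a' b' sa sb sc) (hdeg : Module.finrank ℚ L = 4)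
    (Φ : H ≃+* ℚ × ℚ × QuadraticAlgebra ℚ D 0) (hΦ : ∀ h, ActsAs g a' sa sb sc h (Φ h)) :
    Module.Free (associatedOrder L H) (NumberField.RingOfIntegers L) ↔
      ∃ X Y : ℤ, g * X ^ 2 + a' * Y ^ 2 = 2 ∨ g * X ^ 2 + a' * Y ^ 2 = -2 := by
  have h4 := hB.emod_four
  by_cases hb : g * b' % 4 = 1
  · have hI := hB.isIntegral_iff_quarter hb
    constructor
    · intro hfree
      obtain ⟨x₀, x₁, x₂, x₃, hx, hgen⟩ := exists_generates_of_free hB hdeg hI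
        (by
          rintro _ _ _ _ ⟨n₀, n₁, n₂, n₃, rfl, rfl, rfl, rfl, -⟩
          exact ⟨n₀, n₁, n₂, n₃, by ring, by ring, by ring, by ring⟩)
        (fun n₀ n₁ n₂ n₃ => ⟨4 * n₀, 4 * n₁, 4 * n₂, 4 * n₃, by push_cast; ring,
          by push_cast; ring, by push_cast; ring, by push_cast; ring, by omega, by omega,
          by omega, ⟨n₀ + n₁ + n₂ + g * n₃, by ring⟩⟩) Φ hΦ
      exact hx.norm_eq h4 hB.isCoprime_g hgen
    · rintro ⟨X, Y, hXY⟩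
      obtain ⟨N, hN, hXY⟩ : ∃ N, (N = 2 ∨ N = -2) ∧ g * X ^ 2 + a' * Y ^ 2 = N := ⟨_, hXY, rfl⟩
      obtain ⟨hX, hY⟩ := odd_of_mul_sq_add_mul_sq h4 hN hXY
      obtain ⟨y, hy, hx, hgen⟩ := QuarterLattice.exists_generates h4 hN hXY hX hY
      have hXY' : (g : ℚ) * X ^ 2 + a' * Y ^ 2 = N := by exact_mod_cast hXY
      refine free_of_generates hB hdeg hI Φ hΦ hx (by norm_num) ?_ ?_ hgen
      · intro h
        have : (y : ℚ) = 0 := by linarith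
        rw [Int.cast_eq_zero] at this
        simp [this] at hy
      · rw [show (g : ℚ) * (X / 4) ^ 2 + a' * (Y / 4) ^ 2 = N / 16 by rw [← hXY']; ring]
        rcases hN with rfl | rfl <;> norm_num
  · have hI := hB.isIntegral_iff_half hb
    constructor
    · intro hfree
      obtain ⟨x₀, x₁, x₂, x₃, hx, hgen⟩ := exists_generates_of_free hB hdeg hI
        (by
          rintro _ _ _ _ ⟨n₀, n₁, n₂, n₃, rfl, rfl, rfl, rfl, -⟩
          exact ⟨2 * n₀, 2 * n₁, 2 * n₂, 2 * n₃, by push_cast; ring, by push_cast; ring,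
            by push_cast; ring, by push_cast; ring⟩)
        (fun n₀ n₁ n₂ n₃ => ⟨2 * n₀, 2 * n₁, 2 * n₂, 2 * n₃, by push_cast; ring,
          by push_cast; ring, by push_cast; ring, by push_cast; ring, by omega, by omega⟩) Φ hΦ
      exact hx.norm_eq h4 hB.isCoprime_g hgen
    · rintro ⟨X, Y, hXY⟩
      obtain ⟨N, hN, hXY⟩ : ∃ N, (N = 2 ∨ N = -2) ∧ g * X ^ 2 + a' * Y ^ 2 = N := ⟨_, hXY, rfl⟩
      obtain ⟨hX, hY⟩ := odd_of_mul_sq_add_mul_sq h4 hN hXY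
      obtain ⟨hx, hgen⟩ := HalfLattice.exists_generates h4 hN hXY hX hY
      have hXY' : (g : ℚ) * X ^ 2 + a' * Y ^ 2 = N := by exact_mod_cast hXY
      refine free_of_generates hB hdeg hI Φ hΦ hx (by norm_num) (by norm_num) ?_ hgen
      rw [show (g : ℚ) * (X / 2) ^ 2 + a' * (Y / 2) ^ 2 = N / 4 by rw [← hXY']; ring]
      rcases hN with rfl | rfl <;> norm_num

theorem mainTheorem7 (L : Type*) [Field L] [NumberField L] (a b : ℤ)
    (ha : Squarefree a) (hb : Squarefree b) (ha4 : a ≡ 1 [ZMOD 4])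
    (sa sb : L) (hsa : sa ^ 2 = (a : L)) (hsb : sb ^ 2 = (b : L))
    (hL : IntermediateField.adjoin ℚ {sa, sb} = ⊤) (hdeg : Module.finrank ℚ L = 4)
    (H : Type*) [Ring H] [HopfAlgebra ℚ H] [Module H L] [IsScalarTower ℚ H L]
    (hH : IsHopfGaloisStructure ℚ L H) (hHa : IsGivenBy ℚ L H sa) :
    Nonempty (H ≃ₐ[ℚ] ℚ × ℚ × QuadraticAlgebra ℚ (-(a : ℚ)) 0) ∧
      (Module.Free (associatedOrder L H) (NumberField.RingOfIntegers L) ↔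
        ∃ x y : ℤ, x ^ 2 + a * y ^ 2 = 2 * (Int.gcd a b : ℤ) ∨
          x ^ 2 + a * y ^ 2 = -(2 * (Int.gcd a b : ℤ))) := by
  obtain ⟨σ, τ, hτ, hτa, hσa, φ, hφ⟩ := hHa
  have hsb0 : sb ≠ 0 := by
    rintro rfl
    refine hb.ne_zero (Int.cast_injective (α := L) ?_)
    rw [← hsb]
    simp
  obtain ⟨hG, h1, h2, h3⟩ := isKleinFourPair_of_biquadratic hL hsb0 hsa hsb hτ hτa hσa
  have hgcd : (Int.gcd a b : ℤ) ≠ 0 := by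
    simpa [Int.gcd_eq_zero_iff] using fun h => absurd h ha.ne_zero
  obtain ⟨a', b', hcop, ea, eb⟩ := Int.exists_gcd_one (m := a) (n := b)
    (Int.gcd_pos_of_ne_zero_left b ha.ne_zero)
  generalize (Int.gcd a b : ℤ) = g at *
  obtain rfl : a = g * a' := by rw [ea, mul_comm]
  obtain rfl : b = g * b' := by rw [eb, mul_comm]
  have hg : (g : L) ≠ 0 := Int.cast_ne_zero.2 hgcd
  push_cast at hsa hsb
  have hB : IsBiquadratic L g a' b' sa sb (sa * sb / g) :=
    { sq_a := hsa
      sq_b := hsb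
      mul_eq := by field_simp
      squarefree_a := ha
      squarefree_b := hb
      isCoprime := Int.isCoprime_iff_gcd_eq_one.2 hcop
      emod_four := ha4
      -- An automorphism fixing √b and negating √a is σ or στ, according to the sign of σ on √b.
      exists_aut := by
        rcases h2 with h2 | h2
        · exact ⟨σ, τ, h1, h2, hτa, h3⟩
        · exact ⟨(σ * τ : L ≃ₐ[ℚ] L), τ, by simp [h1, hτa], by simp [h2, h3], hτa, h3⟩ }
  obtain ⟨Φ, hΦ⟩ := exists_algEquiv_actsAs (D := -((g * a' : ℤ) : ℚ)) hB hdeg (by push_cast; rfl)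
    hH (exists_actsAs hB hdeg hG h1 h2 hτa h3 φ hφ)
  refine ⟨⟨Φ⟩, ?_⟩
  rw [free_associatedOrder_iff hB hdeg Φ.toRingEquiv hΦ, ← exists_sq_add_mul_sq_iff hgcd ha]
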